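/- Let $M$ be a smooth manifold of dimension $m$. Let $\Omega(M)=\bigoplus_{n=0}^m\Omega^n(M)$ be its differential forms and $\Omega^k(M;TM)$ the space of smooth tangent bundle valued $k$-forms. For $K\in\Omega^k(M;TM)$ let $i(K):\Omega^q(M)\to\Omega^{q+k-1}(M)$ be the insertion operator, given on decomposable forms by $i(\varphi\otimes X)\omega=\varphi\wedge i_X\omega$, and let $$\Theta(K)=[i(K),d]=i(K)\,d-(-1)^{k-1}d\,i(K)$$ be the Lie derivative along $K$. For $K\in\Omega^k(M;TM)$ and $L\in\Omega^\ell(M;TM)$ let the Frölicher–Nijenhuis bracket $[K,L]\in\Omega^{k+\ell}(M;TM)$ be the unique element with $\Theta([K,L])=\Theta(K)\Theta(L)-(-1)^{k\ell}\Theta(L)\Theta(K)$. Let the contraction $c:\Omega^k(M;TM)\to\Omega^{k-1}(M)$ and the concomitant $S:\Omega^k(M;TM)\times\Omega^\ell(M;TM)\to\Omega^{k+\ell-2}(M)$ be the linear, respectively bilinear, extensions of $$c(\varphi\otimes X)=i_X\varphi,\qquad S(\varphi\otimes X,\psi\otimes Y)=i_Y\varphi\wedge i_X\psi ,$$ where forms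 of negative degree are $0$. **Lemma.** For all $k,\ell\ge 0$, $K\in\Omega^k(M;TM)$ and $L\in\Omega^\ell(M;TM)$, $$c([K,L])=(-1)^k\,\Theta(K)c(L)-(-1)^{k\ell+\ell}\,\Theta(L)c(K)-(-1)^k\,dS(K,L).$$ -/

import Mathlib

open scoped Manifold ContDiff

noncomputable section

namespace FrolicherNijenhuis

/-! ### Alternating forms on a real topological vector space -/

section Pointwise

variable {V : Type*} [AddCommGroup V] [Module ℝ V] [TopologicalSpace V]

/-- The graded space of alternating forms on `V`: an element is a family `α`, whose member `α n` is
its component of degree `n`. If `dim V = m`, the components of degree `> m` vanish automatically, so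
that this is the direct sum of the `Λⁿ V*`, `0 ≤ n ≤ m`. A form `φ` of degree `k` is regarded as the
element `Pi.single k φ`. -/
abbrev AltForms (V : Type*) [AddCommGroup V] [Module ℝ V] [TopologicalSpace V] : Type _ :=
  (n : ℕ) → V [⋀^Fin n]→L[ℝ] ℝ

/-- The multilinear map `(v₁, …, vₙ) ↦ α(v₁, …, v_p) β(v_{p+1}, …, v_n)`, where `p + q = n`. -/
def mulForms {p q n : ℕ} (h : p + q = n) (α : V [⋀^Fin p]→L[ℝ] ℝ) (β : V [⋀^Fin q]→L[ℝ] ℝ) :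
    ContinuousMultilinearMap ℝ (fun _ : Fin n => V) ℝ where
  toMultilinearMap :=
    ((LinearMap.mul' ℝ ℝ).compMultilinearMap
      (α.toMultilinearMap.domCoprod β.toMultilinearMap)).domDomCongr
        (finSumFinEquiv.trans (finCongr h))
  cont := by
    subst h
    change Continuous fun v : Fin (p + q) → V =>
      α (fun i => v (Fin.castAdd q i)) * β (fun i => v (Fin.natAdd p i))
    exact (α.cont.comp (continuous_pi fun i => continuous_apply _)).mul
      (β.cont.comp (continuous_pi fun i => continuous_apply _))

theorem mulForms_apply {p q n : ℕ} (h : p + q = n) (α : V [⋀^Fin p]→L[ℝ] ℝ)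
    (β : V [⋀^Fin q]→L[ℝ] ℝ) (v : Fin n → V) :
    mulForms h α β v = α (fun i => v (Fin.cast h (Fin.castAdd q i))) *
      β (fun i => v (Fin.cast h (Fin.natAdd p i))) := by
  subst h
  rfl

/-- The wedge product of a `p`-form and a `q`-form, where `p + q = n`:
`(α ∧ β)(v₁, …, vₙ) = 1/(p! q!) ∑_σ sign σ · α(v_{σ1}, …, v_{σp}) β(v_{σ(p+1)}, …, v_{σn})`. -/
def wedgeHom {p q n : ℕ} (h : p + q = n) (α : V [⋀^Fin p]→L[ℝ] ℝ) (β : V [⋀^Fin q]→L[ℝ] ℝ) :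
    V [⋀^Fin n]→L[ℝ] ℝ :=
  ((p.factorial : ℝ) * (q.factorial : ℝ))⁻¹ • ContinuousMultilinearMap.alternatization (mulForms h α β)

theorem wedgeHom_apply {p q n : ℕ} (h : p + q = n) (α : V [⋀^Fin p]→L[ℝ] ℝ)
    (β : V [⋀^Fin q]→L[ℝ] ℝ) (v : Fin n → V) :
    wedgeHom h α β v = ((p.factorial : ℝ) * (q.factorial : ℝ))⁻¹ * ∑ σ : Equiv.Perm (Fin n),
      Equiv.Perm.sign σ • (α (fun i => v (σ (Fin.cast h (Fin.castAdd q i)))) *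
        β (fun i => v (σ (Fin.cast h (Fin.natAdd p i))))) := by
  simp [wedgeHom, ContinuousMultilinearMap.alternatization_apply_apply, mulForms_apply]

/-- The wedge product on the graded space of alternating forms:
`(α ∧ β)ₙ = ∑_{p + q = n} α_p ∧ β_q`. -/
def wedge (α β : AltForms V) : AltForms V := fun n =>
  ∑ pq : Finset.HasAntidiagonal.antidiagonal n,
    wedgeHom (Finset.HasAntidiagonal.mem_antidiagonal.1 pq.2) (α pq.1.1) (β pq.1.2)

/-- Insertion of the vector `X` into the first slot, `(i_X α)(v₁, …, vₙ) = α(X, v₁, …, vₙ)`; the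
insertion of a vector into a form of degree `0` is `0`. -/
def interior (X : V) (α : AltForms V) : AltForms V := fun n =>
  { toMultilinearMap := ((α (n + 1)).toAlternatingMap.curryLeft X).toMultilinearMap
    map_eq_zero_of_eq' := ((α (n + 1)).toAlternatingMap.curryLeft X).map_eq_zero_of_eq'
    cont := by
      change Continuous fun v : Fin n → V => α (n + 1) (Fin.cons X v)
      exact (α (n + 1)).cont.comp (Continuous.finCons continuous_const continuous_id) }

theorem interior_apply (X : V) (α : AltForms V) (n : ℕ) (v : Fin n → V) :
    interior X α n v = α (n + 1) (Fin.cons X v) := rfl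

end Pointwise

/-! ### Differential forms on a manifold of dimension `m` -/

section Manifold

variable {m : ℕ} {M : Type*} [TopologicalSpace M] [ChartedSpace (EuclideanSpace ℝ (Fin m)) M]

/-- Fields of elements of `Λ T*M`. Differential forms are the smooth ones among them. -/
abbrev Forms (m : ℕ) (M : Type*) [TopologicalSpace M]
    [ChartedSpace (EuclideanSpace ℝ (Fin m)) M] : Type _ :=
  (x : M) → AltForms (TangentSpace (𝓡 m) x)

/-- Fields of elements of `Λᵏ T*M ⊗ TM`. The elements of `Ωᵏ(M; TM)` are the smooth ones among them,
see `IsSmooth`. -/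
abbrev VectorForms (m : ℕ) (M : Type*) [TopologicalSpace M]
    [ChartedSpace (EuclideanSpace ℝ (Fin m)) M] (k : ℕ) : Type _ :=
  (x : M) → TangentSpace (𝓡 m) x [⋀^Fin k]→L[ℝ] TangentSpace (𝓡 m) x

/-- The expression of (the component of degree `n` of) a form in the chart at `x₀`, that is, its
pullback along the inverse of the chart. -/
def inChart (x₀ : M) (n : ℕ) (η : Forms m M) (y : EuclideanSpace ℝ (Fin m)) :
    EuclideanSpace ℝ (Fin m) [⋀^Fin n]→L[ℝ] ℝ :=
  (η ((extChartAt (𝓡 m) x₀).symm y) n).compContinuousLinearMap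
    (mfderiv 𝓘(ℝ, EuclideanSpace ℝ (Fin m)) (𝓡 m) (extChartAt (𝓡 m) x₀).symm y)

/-- The expression of a vector valued `k`-form in the chart at `x₀`. -/
def vectorInChart (x₀ : M) {k : ℕ} (K : VectorForms m M k) (y : EuclideanSpace ℝ (Fin m)) :
    EuclideanSpace ℝ (Fin m) [⋀^Fin k]→L[ℝ] EuclideanSpace ℝ (Fin m) :=
  (mfderiv (𝓡 m) 𝓘(ℝ, EuclideanSpace ℝ (Fin m)) (extChartAt (𝓡 m) x₀)
      ((extChartAt (𝓡 m) x₀).symm y)).compContinuousAlternatingMap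
    ((K ((extChartAt (𝓡 m) x₀).symm y)).compContinuousLinearMap
      (mfderiv 𝓘(ℝ, EuclideanSpace ℝ (Fin m)) (𝓡 m) (extChartAt (𝓡 m) x₀).symm y))

/-- A vector valued form is smooth if its expressions in the charts of an atlas are smooth. -/
def IsSmooth {k : ℕ} (K : VectorForms m M k) : Prop :=
  ∀ x₀ : M, ContDiffOn ℝ ∞ (vectorInChart x₀ K) (extChartAt (𝓡 m) x₀).target

/-- The exterior derivative `d`, computed at `x` in the chart at `x`. -/
def extD (η : Forms m M) : Forms m M := fun x n =>
  match n with
  | 0 => 0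
  | n + 1 =>
    (extDeriv (inChart x n η) (extChartAt (𝓡 m) x x)).compContinuousLinearMap
      (mfderiv (𝓡 m) 𝓘(ℝ, EuclideanSpace ℝ (Fin m)) (extChartAt (𝓡 m) x) x)

/-- The vector `∂/∂uʲ` at `x`, where `u` is the chart at `x`. -/
def frame (x : M) (j : Fin m) : TangentSpace (𝓡 m) x :=
  (mfderiv (𝓡 m) 𝓘(ℝ, EuclideanSpace ℝ (Fin m)) (extChartAt (𝓡 m) x) x).inverse
    (EuclideanSpace.single j (1 : ℝ))

/-- The covector `duʲ` at `x`, where `u` is the chart at `x`. -/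
def coframe (x : M) (j : Fin m) : TangentSpace (𝓡 m) x →L[ℝ] ℝ :=
  (EuclideanSpace.proj j : EuclideanSpace ℝ (Fin m) →L[ℝ] ℝ).comp
    (mfderiv (𝓡 m) 𝓘(ℝ, EuclideanSpace ℝ (Fin m)) (extChartAt (𝓡 m) x) x)

/-- The components `Kʲ = duʲ ∘ K` of a vector valued form, so that `K = ∑ⱼ Kʲ ⊗ ∂/∂uʲ` at `x`. -/
def component {k : ℕ} (K : VectorForms m M k) (j : Fin m) : Forms m M := fun x =>
  Pi.single k ((coframe x j).compContinuousAlternatingMap (K x))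

/-- The contraction `c(φ ⊗ X) = i_X φ`, linearly extended; it vanishes in degree `0`. -/
def contraction {k : ℕ} (K : VectorForms m M k) : Forms m M := fun x =>
  ∑ j, interior (frame x j) (component K j x)

/-- The insertion operator `i(φ ⊗ X) η = φ ∧ i_X η`, linearly extended; it maps forms of degree `q`
to forms of degree `q + k - 1`. -/
def insertion {k : ℕ} (K : VectorForms m M k) (η : Forms m M) : Forms m M := fun x =>
  ∑ j, wedge (component K j x) (interior (frame x j) (η x))

/-- The Lie derivative `Θ(K) = [i(K), d] = i(K) d - (-1)^(k-1) d i(K)` along `K`; the exponent is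
written `k + 1` to make sense of it for `k = 0`. -/
def lieDeriv {k : ℕ} (K : VectorForms m M k) (η : Forms m M) : Forms m M :=
  insertion K (extD η) - (-1 : ℝ) ^ (k + 1) • extD (insertion K η)

/-- The bilinear concomitant `S(φ ⊗ X, ψ ⊗ Y) = i_Y φ ∧ i_X ψ`, bilinearly extended. -/
def concomitant {k l : ℕ} (K : VectorForms m M k) (L : VectorForms m M l) : Forms m M := fun x =>
  ∑ i, ∑ j, wedge (interior (frame x j) (component K i x))
    (interior (frame x i) (component L j x))

/-- The `j`-th coordinate function of the chart at `x₀`, as a form of degree `0`. -/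
def coordFun (x₀ : M) (j : Fin m) : Forms m M := fun y =>
  Pi.single 0 (ContinuousAlternatingMap.constOfIsEmpty ℝ (TangentSpace (𝓡 m) y) (Fin 0)
    ((extChartAt (𝓡 m) x₀ y).ofLp j))

/-- The graded commutator `[Θ(K), Θ(L)] = Θ(K) Θ(L) - (-1)^(kl) Θ(L) Θ(K)`. -/
def lieDerivComm {k l : ℕ} (K : VectorForms m M k) (L : VectorForms m M l) (η : Forms m M) :
    Forms m M :=
  lieDeriv K (lieDeriv L η) - (-1 : ℝ) ^ (k * l) • lieDeriv L (lieDeriv K η)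

/-- The Frölicher–Nijenhuis bracket. It is defined by `Θ([K, L]) = [Θ(K), Θ(L)]`. As
`Θ(B) f = df ∘ B` for a function `f`, it is obtained by evaluating `[Θ(K), Θ(L)]` on coordinate
functions: `[K, L] = ∑ⱼ ([Θ(K), Θ(L)] uʲ) ⊗ ∂/∂uʲ`. -/
def bracket {k l : ℕ} (K : VectorForms m M k) (L : VectorForms m M l) :
    VectorForms m M (k + l) := fun x =>
  ∑ j, (lieDerivComm K L (coordFun x j) x (k + l)).smulRight (frame x j)

end Manifold

/-! ### The formulas on decomposable vector valued forms -/

section Linearity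

variable {V : Type*} [AddCommGroup V] [Module ℝ V] [TopologicalSpace V]

theorem wedge_sum_smul_left {ι : Type*} (s : Finset ι) (a : ι → ℝ) (α : ι → AltForms V)
    (β : AltForms V) : wedge (∑ i ∈ s, a i • α i) β = ∑ i ∈ s, a i • wedge (α i) β := by
  funext n
  ext v
  simp only [wedge, Finset.sum_apply, Pi.smul_apply, ContinuousAlternatingMap.sum_apply,
    ContinuousAlternatingMap.smul_apply, wedgeHom_apply, smul_eq_mul, Finset.sum_mul,
    Finset.mul_sum, Finset.smul_sum]
  rw [Finset.sum_comm' (s := s) (t' := Finset.univ) (s' := fun _ => s) (by simp)]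
  refine Finset.sum_congr rfl fun pq _ => ?_
  rw [Finset.sum_comm]
  refine Finset.sum_congr rfl fun i _ => Finset.sum_congr rfl fun σ _ => ?_
  rw [mul_assoc, mul_smul_comm, mul_smul_comm, mul_smul_comm]
  congr 1
  ring

theorem wedge_sum_smul_right {ι : Type*} (s : Finset ι) (a : ι → ℝ) (α : AltForms V)
    (β : ι → AltForms V) : wedge α (∑ i ∈ s, a i • β i) = ∑ i ∈ s, a i • wedge α (β i) := by
  funext n
  ext v
  simp only [wedge, Finset.sum_apply, Pi.smul_apply, ContinuousAlternatingMap.sum_apply,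
    ContinuousAlternatingMap.smul_apply, wedgeHom_apply, smul_eq_mul, 
    Finset.mul_sum, Finset.smul_sum]
  rw [Finset.sum_comm' (s := s) (t' := Finset.univ) (s' := fun _ => s) (by simp)]
  refine Finset.sum_congr rfl fun pq _ => ?_
  rw [Finset.sum_comm]
  refine Finset.sum_congr rfl fun i _ => Finset.sum_congr rfl fun σ _ => ?_
  rw [mul_smul_comm, mul_smul_comm, mul_smul_comm]
  congr 1
  ring

theorem interior_sum_smul {ι : Type*} (s : Finset ι) (a : ι → ℝ) (X : ι → V) (α : AltForms V) :
    interior (∑ i ∈ s, a i • X i) α = ∑ i ∈ s, a i • interior (X i) α := by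
  funext n
  ext v
  simp only [Finset.sum_apply, Pi.smul_apply, ContinuousAlternatingMap.sum_apply,
    ContinuousAlternatingMap.smul_apply, interior_apply]
  let g : V →ₗ[ℝ] ℝ :=
    { toFun := fun Z => α (n + 1) (Fin.cons Z v)
      map_add' := fun Z Z' => (α (n + 1)).toMultilinearMap.cons_add v Z Z'
      map_smul' := fun c Z => (α (n + 1)).toMultilinearMap.cons_smul v c Z }
  have h : g (∑ i ∈ s, a i • X i) = ∑ i ∈ s, a i • g (X i) := by
    simp only [map_sum, map_smul]
  exact h

theorem interior_smul_form (X : V) (a : ℝ) (α : AltForms V) :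
    interior X (a • α) = a • interior X α := rfl

end Linearity

section Decomposable

variable {m : ℕ} {M : Type*} [TopologicalSpace M] [ChartedSpace (EuclideanSpace ℝ (Fin m)) M]

/-- The decomposable vector valued form `φ ⊗ X`. -/
def tensor {k : ℕ} (φ : (x : M) → TangentSpace (𝓡 m) x [⋀^Fin k]→L[ℝ] ℝ)
    (X : (x : M) → TangentSpace (𝓡 m) x) : VectorForms m M k := fun x => (φ x).smulRight (X x)

theorem sum_coframe_smul_frame [IsManifold (𝓡 m) ∞ M] (x : M) (X : TangentSpace (𝓡 m) x) :
    ∑ j, coframe x j X • frame x j = X := by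
  obtain ⟨e, he⟩ := isInvertible_mfderiv_extChartAt (I := 𝓡 m) (mem_extChartAt_source x)
  have key : ∀ w : EuclideanSpace ℝ (Fin m),
      ∑ j, w j • EuclideanSpace.single j (1 : ℝ) = w := fun w => by
    simpa using (EuclideanSpace.basisFun (Fin m) ℝ).sum_repr w
  let f : EuclideanSpace ℝ (Fin m) →L[ℝ] TangentSpace (𝓡 m) x :=
    (e.symm : TangentSpace 𝓘(ℝ, EuclideanSpace ℝ (Fin m)) (extChartAt (𝓡 m) x x) →L[ℝ] _)
  let w : EuclideanSpace ℝ (Fin m) := e X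
  have h : f (∑ j, w j • EuclideanSpace.single j (1 : ℝ)) = X :=
    (congrArg f (key w)).trans (e.symm_apply_apply X)
  simp only [map_sum, map_smul] at h
  simp only [coframe, frame, ← he, ContinuousLinearMap.inverse_equiv]
  exact h

theorem component_tensor {k : ℕ} (φ : (x : M) → TangentSpace (𝓡 m) x [⋀^Fin k]→L[ℝ] ℝ)
    (X : (x : M) → TangentSpace (𝓡 m) x) (j : Fin m) (x : M) :
    component (tensor φ X) j x = coframe x j (X x) • (Pi.single k (φ x) : AltForms _) := by
  rw [component, ← Pi.single_smul]
  congr 1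
  ext v
  simp [tensor, mul_comm]

variable [IsManifold (𝓡 m) ∞ M]

theorem contraction_tensor {k : ℕ} (φ : (x : M) → TangentSpace (𝓡 m) x [⋀^Fin k]→L[ℝ] ℝ)
    (X : (x : M) → TangentSpace (𝓡 m) x) (x : M) :
    contraction (tensor φ X) x = interior (X x) (Pi.single k (φ x)) := by
  simp only [contraction, component_tensor, interior_smul_form, ← interior_sum_smul,
    sum_coframe_smul_frame]

theorem insertion_tensor {k : ℕ} (φ : (x : M) → TangentSpace (𝓡 m) x [⋀^Fin k]→L[ℝ] ℝ)
    (X : (x : M) → TangentSpace (𝓡 m) x) (η : Forms m M) (x : M) :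
    insertion (tensor φ X) η x = wedge (Pi.single k (φ x)) (interior (X x) (η x)) := by
  have h : ∀ (a : ℝ) (α β : AltForms (TangentSpace (𝓡 m) x)), wedge (a • α) β = a • wedge α β :=
    fun a α β => by simpa using wedge_sum_smul_left {()} (fun _ => a) (fun _ => α) β
  simp only [insertion, component_tensor, h, ← wedge_sum_smul_right, ← interior_sum_smul,
    sum_coframe_smul_frame]

theorem concomitant_tensor {k l : ℕ} (φ : (x : M) → TangentSpace (𝓡 m) x [⋀^Fin k]→L[ℝ] ℝ)
    (X : (x : M) → TangentSpace (𝓡 m) x) (ψ : (x : M) → TangentSpace (𝓡 m) x [⋀^Fin l]→L[ℝ] ℝ)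
    (Y : (x : M) → TangentSpace (𝓡 m) x) (x : M) :
    concomitant (tensor φ X) (tensor ψ Y) x =
      wedge (interior (Y x) (Pi.single k (φ x))) (interior (X x) (Pi.single l (ψ x))) := by
  have h : ∀ (a : ℝ) (α β : AltForms (TangentSpace (𝓡 m) x)), wedge α (a • β) = a • wedge α β :=
    fun a α β => by simpa using wedge_sum_smul_right {()} (fun _ => a) α (fun _ => β)
  have h' : ∀ (a : ℝ) (α β : AltForms (TangentSpace (𝓡 m) x)), wedge (a • α) β = a • wedge α β :=
    fun a α β => by simpa using wedge_sum_smul_left {()} (fun _ => a) (fun _ => α) β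
  have hX := interior_sum_smul Finset.univ (fun i => coframe x i (X x)) (frame x)
    (Pi.single l (ψ x))
  have hY := interior_sum_smul Finset.univ (fun j => coframe x j (Y x)) (frame x)
    (Pi.single k (φ x))
  rw [sum_coframe_smul_frame] at hX hY
  rw [hX, hY, wedge_sum_smul_right]
  simp only [concomitant, component_tensor, interior_smul_form, h, h', wedge_sum_smul_left,
    Finset.smul_sum]
  exact Finset.sum_congr rfl fun i _ => Finset.sum_congr rfl fun j _ => smul_comm _ _ _

end Decomposable

end FrolicherNijenhuis

end

/-! The identity is checked at a point `x` in the chart `u` at `x`. There `K = ∑ κ_a ⊗ e_a` and `L =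
∑ μ_j ⊗ e_j` with constant vectors `e_a`. Since `i(L) uʲ = 0`, one has `Θ(L) uʲ = i(L) duʲ = μ_j`,
so the components of `[K, L]` are `Θ(K) μ_j - (-1)^(kl) Θ(L) κ_j`, and `c([K, L])` is obtained by
inserting `e_j` and summing over `j`.

For constant `X` and `Y`, moving `i_X` past `Θ(κ ⊗ Y)` requires only that `i_X` is an antiderivation
(`interior_wedge`), that insertions anticommute, and Cartan's formula `i_X d = ∂_X - d i_X`
(`interior_localD`). The result is `(-1)^k Θ(κ ⊗ Y) i_X μ` plus `contractionDefect`
(`interior_lieDeriv_decomposable`). Summed up, the main terms are the two Lie derivatives of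
contractions. By the Leibniz rule (`localD_wedge`) and graded commutativity (`wedge_comm`), the
graded antisymmetrization of the defect is `-(-1)^k d(i_X κ ∧ i_Y μ)`, which gives the concomitant
term (`contractionDefect_comm`, `sum_interior_bracket`).

To pass from `M` to coordinates, two points matter. At each point the operators are defined through
the frame of that point's own chart, but they are traces over a frame and its dual coframe, so the
frame of a single chart serves instead (`sum_dual_frame`). The exterior derivative at `p` is
likewise taken in the chart at `p`; general chart independence is avoided, because away from `x`
only the differentials `duʲ` are needed, and for those the chain rule suffices
(`fderiv_coord_comp_chartDeriv`). No second derivative of `K` or `L` occurs, and `d² = 0` is not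
used. -/

open scoped Manifold ContDiff

noncomputable section

namespace FrolicherNijenhuis

/-! ### Permutations sorted by the position of the first vector. -/

section Permutations

/-- The permutation of `Fin (n + 1)` sending `i` to `0` and the rest to the successors by `τ`. -/
def extendPerm {n : ℕ} (i : Fin (n + 1)) (τ : Equiv.Perm (Fin n)) : Equiv.Perm (Fin (n + 1)) :=
  Equiv.Perm.decomposeFin.symm (0, τ) * i.cycleRange

theorem extendPerm_self {n : ℕ} (i : Fin (n + 1)) (τ : Equiv.Perm (Fin n)) :
    extendPerm i τ i = 0 := by
  simp [extendPerm]

theorem extendPerm_succAbove {n : ℕ} (i : Fin (n + 1)) (τ : Equiv.Perm (Fin n)) (j : Fin n) :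
    extendPerm i τ (i.succAbove j) = (τ j).succ := by
  simp [extendPerm]

theorem sign_extendPerm {n : ℕ} (i : Fin (n + 1)) (τ : Equiv.Perm (Fin n)) :
    Equiv.Perm.sign (extendPerm i τ) = (-1) ^ (i : ℕ) * Equiv.Perm.sign τ := by
  simp [extendPerm, Fin.sign_cycleRange, mul_comm]

/-- The position `i` is recovered as the preimage of `0`, and `τ` from the values on the other
positions; then `(n + 1) · n! = (n + 1)!` gives surjectivity. -/
theorem extendPerm_bijective (n : ℕ) : Function.Bijective
    fun p : Fin (n + 1) × Equiv.Perm (Fin n) => extendPerm p.1 p.2 := by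
  rw [Fintype.bijective_iff_injective_and_card]
  refine ⟨?_, ?_⟩
  · rintro ⟨i, τ⟩ ⟨i', τ'⟩ h
    simp only at h
    have hi : i = i' := by
      apply (extendPerm i' τ').injective
      rw [extendPerm_self, ← h, extendPerm_self]
    subst hi
    congr 1
    ext j
    have := congrArg (fun σ => σ (i.succAbove j)) h
    simp only [extendPerm_succAbove] at this
    rw [Fin.succ_injective _ this]
  · simp [Fintype.card_perm, Nat.factorial_succ]

theorem cons_comp_extendPerm {V : Type*} {n : ℕ} (X : V) (v : Fin n → V) (i : Fin (n + 1))
    (τ : Equiv.Perm (Fin n)) :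
    (Fin.cons X v : Fin (n + 1) → V) ∘ extendPerm i τ = i.insertNth X (v ∘ τ) := by
  ext j
  refine Fin.succAboveCases i ?_ (fun j => ?_) j
  · simp [extendPerm_self]
  · simp [extendPerm_succAbove]

/-- Laplace-type expansion of an antisymmetrization along the slot that receives `X`; the sign
`(-1)^i` is that of the cycle bringing slot `i` to the front. -/
theorem sum_perm_cons {V : Type*} {n : ℕ} (X : V) (v : Fin n → V) (F : (Fin (n + 1) → V) → ℝ) :
    ∑ σ : Equiv.Perm (Fin (n + 1)), Equiv.Perm.sign σ • F ((Fin.cons X v : Fin (n + 1) → V) ∘ σ) =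
      ∑ i : Fin (n + 1), (-1 : ℝ) ^ (i : ℕ) *
        ∑ τ : Equiv.Perm (Fin n), Equiv.Perm.sign τ • F (i.insertNth X (v ∘ τ)) := by
  rw [← (Equiv.ofBijective _ (extendPerm_bijective n)).sum_comp, Fintype.sum_prod_type]
  refine Finset.sum_congr rfl fun i _ => ?_
  rw [Finset.mul_sum]
  refine Finset.sum_congr rfl fun τ _ => ?_
  simp only [Equiv.ofBijective_apply, cons_comp_extendPerm, sign_extendPerm, Units.smul_def,
    zsmul_eq_mul]
  push_cast
  ring

/-- This lemma and the next three split a family with `X` inserted into its first `p` and last `q`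
entries: the block containing the slot receives `X`, the other block is unaffected. -/
theorem insertNth_comp_castAdd {V : Type*} {p q n : ℕ} (h : p + 1 + q = n + 1) (h' : p + q = n)
    (i : Fin (p + 1)) (X : V) (u : Fin n → V) :
    (fun j => (Fin.cast h (Fin.castAdd q i)).insertNth (α := fun _ => V) X u
      (Fin.cast h (Fin.castAdd q j))) =
      i.insertNth (α := fun _ => V) X fun j => u (Fin.cast h' (Fin.castAdd q j)) := by
  ext j
  refine Fin.succAboveCases i ?_ (fun j => ?_) j
  · simp
  · have : Fin.cast h (Fin.castAdd q (i.succAbove j)) =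
        (Fin.cast h (Fin.castAdd q i)).succAbove (Fin.cast h' (Fin.castAdd q j)) := by
      ext
      simp only [Fin.succAbove, Fin.lt_def, Fin.val_cast, Fin.val_castAdd, Fin.val_castSucc]
      split <;> simp
    rw [this]
    simp

theorem insertNth_castAdd_comp_natAdd {V : Type*} {p q n : ℕ} (h : p + 1 + q = n + 1)
    (h' : p + q = n) (i : Fin (p + 1)) (X : V) (u : Fin n → V) :
    (fun j => (Fin.cast h (Fin.castAdd q i)).insertNth (α := fun _ => V) X u
      (Fin.cast h (Fin.natAdd (p + 1) j))) = fun j => u (Fin.cast h' (Fin.natAdd p j)) := by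
  ext j
  have : Fin.cast h (Fin.natAdd (p + 1) j) =
      (Fin.cast h (Fin.castAdd q i)).succAbove (Fin.cast h' (Fin.natAdd p j)) := by
    have := i.2
    ext
    simp only [Fin.succAbove, Fin.lt_def, Fin.val_cast, Fin.val_castAdd, Fin.val_castSucc,
      Fin.val_natAdd]
    rw [if_neg (by omega)]
    simp
    omega
  rw [this]
  simp

theorem insertNth_natAdd_comp_natAdd {V : Type*} {p q n : ℕ} (h : p + (q + 1) = n + 1)
    (h' : p + q = n) (i : Fin (q + 1)) (X : V) (u : Fin n → V) :
    (fun j => (Fin.cast h (Fin.natAdd p i)).insertNth (α := fun _ => V) X u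
      (Fin.cast h (Fin.natAdd p j))) =
      i.insertNth (α := fun _ => V) X fun j => u (Fin.cast h' (Fin.natAdd p j)) := by
  ext j
  refine Fin.succAboveCases i ?_ (fun j => ?_) j
  · simp
  · have : Fin.cast h (Fin.natAdd p (i.succAbove j)) =
        (Fin.cast h (Fin.natAdd p i)).succAbove (Fin.cast h' (Fin.natAdd p j)) := by
      ext
      simp only [Fin.succAbove, Fin.lt_def, Fin.val_cast, Fin.val_natAdd, Fin.val_castSucc,
        add_lt_add_iff_left]
      split <;> simp [add_assoc]
    rw [this]
    simp

theorem insertNth_natAdd_comp_castAdd {V : Type*} {p q n : ℕ} (h : p + (q + 1) = n + 1)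
    (h' : p + q = n) (i : Fin (q + 1)) (X : V) (u : Fin n → V) :
    (fun j => (Fin.cast h (Fin.natAdd p i)).insertNth (α := fun _ => V) X u
      (Fin.cast h (Fin.castAdd (q + 1) j))) = fun j => u (Fin.cast h' (Fin.castAdd q j)) := by
  ext j
  have : Fin.cast h (Fin.castAdd (q + 1) j) =
      (Fin.cast h (Fin.natAdd p i)).succAbove (Fin.cast h' (Fin.castAdd q j)) := by
    have := j.2
    ext
    simp only [Fin.succAbove, Fin.lt_def, Fin.val_cast, Fin.val_castAdd, Fin.val_castSucc,
      Fin.val_natAdd]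
    rw [if_pos (by omega)]
    simp
  rw [this]
  simp

end Permutations

/-! ### Insertion as an antiderivation of the wedge product. -/

section Exterior

variable {V : Type*} [AddCommGroup V] [Module ℝ V] [TopologicalSpace V]

theorem map_insertNth_eq {n : ℕ} (α : V [⋀^Fin (n + 1)]→L[ℝ] ℝ) (i : Fin (n + 1)) (X : V)
    (v : Fin n → V) : α (i.insertNth X v) = (-1 : ℝ) ^ (i : ℕ) * α (Fin.cons X v) := by
  have := α.toAlternatingMap.map_insertNth i X v
  simp only [zsmul_eq_mul] at this
  push_cast at this
  exact this

/-- The product of a `p`-form and a `q`-form, antisymmetrized without normalization. -/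
def rawWedge {p q n : ℕ} (h : p + q = n) (α : V [⋀^Fin p]→L[ℝ] ℝ) (β : V [⋀^Fin q]→L[ℝ] ℝ)
    (v : Fin n → V) : ℝ :=
  ∑ σ : Equiv.Perm (Fin n), Equiv.Perm.sign σ •
    (α (fun i => v (σ (Fin.cast h (Fin.castAdd q i)))) *
      β (fun i => v (σ (Fin.cast h (Fin.natAdd p i)))))

/-- Insertion of a vector into the first slot of a form of positive degree. -/
def insertVec (X : V) {n : ℕ} (α : V [⋀^Fin (n + 1)]→L[ℝ] ℝ) : V [⋀^Fin n]→L[ℝ] ℝ :=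
  interior X (Pi.single (n + 1) α) n

theorem insertVec_apply (X : V) {n : ℕ} (α : V [⋀^Fin (n + 1)]→L[ℝ] ℝ) (v : Fin n → V) :
    insertVec X α v = α (Fin.cons X v) := by
  simp [insertVec, interior_apply]

theorem interior_eq_insertVec (X : V) (α : AltForms V) (n : ℕ) :
    interior X α n = insertVec X (α (n + 1)) := by
  ext v
  rw [insertVec_apply, interior_apply]

theorem neg_one_pow_mul_self (i : ℕ) : (-1 : ℝ) ^ i * (-1 : ℝ) ^ i = 1 := by
  rw [← pow_add, Even.neg_one_pow ⟨i, rfl⟩]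

theorem rawWedge_cons {p q n : ℕ} (h : p + q = n + 1) (α : V [⋀^Fin p]→L[ℝ] ℝ)
    (β : V [⋀^Fin q]→L[ℝ] ℝ) (X : V) (v : Fin n → V) :
    rawWedge h α β (Fin.cons X v) =
      (∑ i : Fin p, (-1 : ℝ) ^ (i : ℕ) * ∑ τ : Equiv.Perm (Fin n), Equiv.Perm.sign τ •
        (α (fun j => (Fin.cast h (Fin.castAdd q i)).insertNth (α := fun _ => V) X (v ∘ τ)
            (Fin.cast h (Fin.castAdd q j))) *
          β (fun j => (Fin.cast h (Fin.castAdd q i)).insertNth (α := fun _ => V) X (v ∘ τ)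
            (Fin.cast h (Fin.natAdd p j))))) +
      ∑ i : Fin q, (-1 : ℝ) ^ (p + i : ℕ) * ∑ τ : Equiv.Perm (Fin n), Equiv.Perm.sign τ •
        (α (fun j => (Fin.cast h (Fin.natAdd p i)).insertNth (α := fun _ => V) X (v ∘ τ)
            (Fin.cast h (Fin.castAdd q j))) *
          β (fun j => (Fin.cast h (Fin.natAdd p i)).insertNth (α := fun _ => V) X (v ∘ τ)
            (Fin.cast h (Fin.natAdd p j)))) := by
  refine (sum_perm_cons X v fun w => α (fun i => w (Fin.cast h (Fin.castAdd q i))) *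
      β (fun i => w (Fin.cast h (Fin.natAdd p i)))).trans ?_
  refine (Equiv.sum_comp (finCongr h) _).symm.trans ?_
  rw [Fin.sum_univ_add]
  simp

/-- Moving `X` to the front of `α` costs `(-1)^i`, which cancels the sign of the expansion, so all
`p + 1` slots contribute equally. The factor `p + 1` later turns `1/(p+1)!` into `1/p!`. -/
theorem rawWedge_cons_left {p q n : ℕ} (h : p + 1 + q = n + 1) (h' : p + q = n)
    (α : V [⋀^Fin (p + 1)]→L[ℝ] ℝ) (β : V [⋀^Fin q]→L[ℝ] ℝ) (X : V) (v : Fin n → V) :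
    (∑ i : Fin (p + 1), (-1 : ℝ) ^ (i : ℕ) * ∑ τ : Equiv.Perm (Fin n), Equiv.Perm.sign τ •
        (α (fun j => (Fin.cast h (Fin.castAdd q i)).insertNth (α := fun _ => V) X (v ∘ τ)
            (Fin.cast h (Fin.castAdd q j))) *
          β (fun j => (Fin.cast h (Fin.castAdd q i)).insertNth (α := fun _ => V) X (v ∘ τ)
            (Fin.cast h (Fin.natAdd (p + 1) j))))) =
      (p + 1) * rawWedge h' (insertVec X α) β v := by
  have : ∀ i : Fin (p + 1), ((-1 : ℝ) ^ (i : ℕ) * ∑ τ : Equiv.Perm (Fin n), Equiv.Perm.sign τ •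
        (α (fun j => (Fin.cast h (Fin.castAdd q i)).insertNth (α := fun _ => V) X (v ∘ τ)
            (Fin.cast h (Fin.castAdd q j))) *
          β (fun j => (Fin.cast h (Fin.castAdd q i)).insertNth (α := fun _ => V) X (v ∘ τ)
            (Fin.cast h (Fin.natAdd (p + 1) j))))) = rawWedge h' (insertVec X α) β v := by
    intro i
    rw [Finset.mul_sum, rawWedge]
    refine Finset.sum_congr rfl fun τ _ => ?_
    rw [insertNth_comp_castAdd h h', insertNth_castAdd_comp_natAdd h h', map_insertNth_eq,
      insertVec_apply, mul_smul_comm, ← mul_assoc, ← mul_assoc, neg_one_pow_mul_self, one_mul]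
    rfl
  simp [this]

/-- As for the left factor, except that `X` also has to pass the `p` arguments of `α`, which leaves
the sign `(-1)^p`. -/
theorem rawWedge_cons_right {p q n : ℕ} (h : p + (q + 1) = n + 1) (h' : p + q = n)
    (α : V [⋀^Fin p]→L[ℝ] ℝ) (β : V [⋀^Fin (q + 1)]→L[ℝ] ℝ) (X : V) (v : Fin n → V) :
    (∑ i : Fin (q + 1), (-1 : ℝ) ^ (p + i : ℕ) * ∑ τ : Equiv.Perm (Fin n), Equiv.Perm.sign τ •
        (α (fun j => (Fin.cast h (Fin.natAdd p i)).insertNth (α := fun _ => V) X (v ∘ τ)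
            (Fin.cast h (Fin.castAdd (q + 1) j))) *
          β (fun j => (Fin.cast h (Fin.natAdd p i)).insertNth (α := fun _ => V) X (v ∘ τ)
            (Fin.cast h (Fin.natAdd p j))))) =
      (q + 1) * ((-1) ^ p * rawWedge h' α (insertVec X β) v) := by
  have : ∀ i : Fin (q + 1), ((-1 : ℝ) ^ (p + i : ℕ) *
      ∑ τ : Equiv.Perm (Fin n), Equiv.Perm.sign τ •
        (α (fun j => (Fin.cast h (Fin.natAdd p i)).insertNth (α := fun _ => V) X (v ∘ τ)
            (Fin.cast h (Fin.castAdd (q + 1) j))) *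
          β (fun j => (Fin.cast h (Fin.natAdd p i)).insertNth (α := fun _ => V) X (v ∘ τ)
            (Fin.cast h (Fin.natAdd p j))))) = (-1) ^ p * rawWedge h' α (insertVec X β) v := by
    intro i
    rw [pow_add, mul_assoc, rawWedge]
    congr 1
    rw [Finset.mul_sum]
    refine Finset.sum_congr rfl fun τ _ => ?_
    rw [insertNth_natAdd_comp_natAdd h h', insertNth_natAdd_comp_castAdd h h', map_insertNth_eq,
      insertVec_apply, mul_smul_comm, mul_left_comm, ← mul_assoc ((-1 : ℝ) ^ _),
      neg_one_pow_mul_self, one_mul]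
    rfl
  simp [this]

/-- The wedge product as a total function of the degrees, zero unless they fit. -/
def wedgeAt (n : ℕ) (pq : ℕ × ℕ) (α : V [⋀^Fin pq.1]→L[ℝ] ℝ) (β : V [⋀^Fin pq.2]→L[ℝ] ℝ)
    (v : Fin n → V) : ℝ :=
  if h : pq.1 + pq.2 = n then
    ((pq.1.factorial : ℝ) * (pq.2.factorial : ℝ))⁻¹ * rawWedge h α β v else 0

/-- With the degree proof hidden in `wedgeAt`, the sum runs over plain pairs and can be reindexed.
-/
theorem wedge_apply (α β : AltForms V) (n : ℕ) (v : Fin n → V) :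
    wedge α β n v =
      ∑ pq ∈ Finset.HasAntidiagonal.antidiagonal n, wedgeAt n pq (α pq.1) (β pq.2) v := by
  rw [wedge, ContinuousAlternatingMap.sum_apply]
  refine Eq.trans (Finset.sum_congr rfl fun pq _ => ?_) (Finset.sum_coe_sort
    (Finset.HasAntidiagonal.antidiagonal n) fun pq => wedgeAt n pq (α pq.1) (β pq.2) v)
  rw [wedgeHom_apply, wedgeAt, dif_pos (Finset.HasAntidiagonal.mem_antidiagonal.1 pq.2)]
  rfl

/-- The grading involution, multiplication by `(-1)ⁿ` in degree `n`. -/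
def gradeInv (α : AltForms V) : AltForms V := fun n => (-1 : ℝ) ^ n • α n

theorem rawWedge_smul_left {p q n : ℕ} (h : p + q = n) (a : ℝ) (α : V [⋀^Fin p]→L[ℝ] ℝ)
    (β : V [⋀^Fin q]→L[ℝ] ℝ) (v : Fin n → V) :
    rawWedge h (a • α) β v = a * rawWedge h α β v := by
  simp only [rawWedge, Finset.mul_sum, ContinuousAlternatingMap.smul_apply, smul_eq_mul,
    mul_smul_comm, mul_assoc]

/-- Insertion of a vector is an antiderivation of the wedge product. -/
theorem interior_wedge (X : V) (α β : AltForms V) :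
    interior X (wedge α β) =
      wedge (interior X α) β + wedge (gradeInv α) (interior X β) := by
  funext n
  ext v
  rw [interior_apply, Pi.add_apply, ContinuousAlternatingMap.add_apply, wedge_apply, wedge_apply,
    wedge_apply]
  -- `A` collects the terms with `X` in the left factor, `B` those with `X` in the right one; a
  -- factor of degree `0` has no slot for `X`.
  let A : ℕ × ℕ → ℝ := fun pq => match pq with
    | (0, _) => 0
    | (p + 1, q) => wedgeAt n (p, q) (insertVec X (α (p + 1))) (β q) v
  let B : ℕ × ℕ → ℝ := fun pq => match pq with
    | (_, 0) => 0
    | (p, q + 1) => wedgeAt n (p, q) (gradeInv α p) (insertVec X (β (q + 1))) v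
  have hAB : ∀ pq ∈ Finset.HasAntidiagonal.antidiagonal (n + 1),
      wedgeAt (n + 1) pq (α pq.1) (β pq.2) (Fin.cons X v) = A pq + B pq := by
    rintro ⟨p, q⟩ hpq
    have h := Finset.HasAntidiagonal.mem_antidiagonal.1 hpq
    simp only at h
    rw [wedgeAt, dif_pos h, rawWedge_cons, mul_add]
    congr 1
    · cases p with
      | zero => simp [A]
      | succ p =>
        have h' : p + q = n := by omega
        simp only [A, wedgeAt, dif_pos h']
        rw [rawWedge_cons_left h h', Nat.factorial_succ]
        have := Nat.factorial_ne_zero p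
        have := Nat.factorial_ne_zero q
        push_cast
        field_simp
    · cases q with
      | zero => simp [B]
      | succ q =>
        have h' : p + q = n := by omega
        simp only [B, wedgeAt, dif_pos h', gradeInv]
        rw [rawWedge_cons_right h h', Nat.factorial_succ, rawWedge_smul_left]
        have := Nat.factorial_ne_zero p
        have := Nat.factorial_ne_zero q
        push_cast
        field_simp
  -- The boundary terms of `A` and `B` vanish, and lowering one degree by `1` turns both sums into
  -- sums over the antidiagonal of `n`.
  rw [Finset.sum_congr rfl hAB, Finset.sum_add_distrib, Finset.Nat.sum_antidiagonal_succ,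
    Finset.Nat.sum_antidiagonal_succ']
  simp only [A, B, zero_add, interior_eq_insertVec]

end Exterior

/-! ### Bilinearity, parity, degree, pullback and frame independence. -/

section Algebra

variable {V W : Type*} [AddCommGroup V] [Module ℝ V] [TopologicalSpace V]
  [AddCommGroup W] [Module ℝ W] [TopologicalSpace W]

theorem wedge_add_left (α α' β : AltForms V) :
    wedge (α + α') β = wedge α β + wedge α' β := by
  simpa using wedge_sum_smul_left Finset.univ (fun _ : Fin 2 => (1 : ℝ)) ![α, α'] β

theorem wedge_smul_left (a : ℝ) (α β : AltForms V) : wedge (a • α) β = a • wedge α β := by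
  simpa using wedge_sum_smul_left {()} (fun _ => a) (fun _ => α) β

theorem wedge_add_right (α β β' : AltForms V) :
    wedge α (β + β') = wedge α β + wedge α β' := by
  simpa using wedge_sum_smul_right Finset.univ (fun _ : Fin 2 => (1 : ℝ)) α ![β, β']

theorem wedge_smul_right (a : ℝ) (α β : AltForms V) : wedge α (a • β) = a • wedge α β := by
  simpa using wedge_sum_smul_right {()} (fun _ => a) α (fun _ => β)

theorem interior_add_vector (X Y : V) (α : AltForms V) :
    interior (X + Y) α = interior X α + interior Y α := by
  simpa using interior_sum_smul Finset.univ (fun _ : Fin 2 => (1 : ℝ)) ![X, Y] α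

theorem interior_smul_vector (a : ℝ) (X : V) (α : AltForms V) :
    interior (a • X) α = a • interior X α := by
  simpa using interior_sum_smul {()} (fun _ => a) (fun _ => X) α

theorem interior_add_form (X : V) (α β : AltForms V) :
    interior X (α + β) = interior X α + interior X β := rfl

/-- The wedge product as a bilinear map. -/
def wedgeL : AltForms V →ₗ[ℝ] AltForms V →ₗ[ℝ] AltForms V :=
  LinearMap.mk₂ ℝ wedge wedge_add_left wedge_smul_left wedge_add_right wedge_smul_right

/-- The insertion of vectors as a bilinear map. -/
def interiorL : V →ₗ[ℝ] AltForms V →ₗ[ℝ] AltForms V :=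
  LinearMap.mk₂ ℝ interior interior_add_vector interior_smul_vector interior_add_form
    fun a X α => interior_smul_form X a α

theorem wedge_sum_right {ι : Type*} (s : Finset ι) (α : AltForms V) (β : ι → AltForms V) :
    wedge α (∑ i ∈ s, β i) = ∑ i ∈ s, wedge α (β i) := map_sum (wedgeL α) β s

theorem wedge_sub_left (α α' β : AltForms V) :
    wedge (α - α') β = wedge α β - wedge α' β := map_sub (wedgeL.flip β) α α'

theorem wedge_sub_right (α β β' : AltForms V) :
    wedge α (β - β') = wedge α β - wedge α β' := map_sub (wedgeL α) β β'

theorem wedge_neg_left (α β : AltForms V) : wedge (-α) β = -wedge α β := map_neg (wedgeL.flip β) α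

theorem wedge_neg_right (α β : AltForms V) : wedge α (-β) = -wedge α β := map_neg (wedgeL α) β

theorem wedge_zero_right (α : AltForms V) : wedge α 0 = 0 := map_zero (wedgeL α)

theorem interior_sum_form {ι : Type*} (s : Finset ι) (X : V) (α : ι → AltForms V) :
    interior X (∑ i ∈ s, α i) = ∑ i ∈ s, interior X (α i) := map_sum (interiorL X) α s

theorem interior_sub_form (X : V) (α β : AltForms V) :
    interior X (α - β) = interior X α - interior X β := map_sub (interiorL X) α β

theorem interior_interior_swap (X Y : V) (α : AltForms V) :
    interior X (interior Y α) = -interior Y (interior X α) := by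
  funext n
  ext v
  rw [interior_apply, interior_apply, Pi.neg_apply, ContinuousAlternatingMap.neg_apply,
    interior_apply, interior_apply]
  have h := (α (n + 1 + 1)).toAlternatingMap.map_swap
    (Fin.cons Y (Fin.cons X v : Fin (n + 1) → V) : Fin (n + 1 + 1) → V) (i := 0) (j := 1) (by simp)
  have e : (Fin.cons X (Fin.cons Y v : Fin (n + 1) → V) : Fin (n + 1 + 1) → V) ∘
      Equiv.swap 0 1 = (Fin.cons Y (Fin.cons X v : Fin (n + 1) → V) : Fin (n + 1 + 1) → V) := by
    ext i
    refine Fin.cases ?_ (fun i => Fin.cases ?_ (fun i => ?_) i) i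
    · simp only [Function.comp_apply, Equiv.swap_apply_left, Fin.cons_zero]
      rfl
    · simp
    · rw [Function.comp_apply, Equiv.swap_apply_of_ne_of_ne (by simp) (by simp [Fin.ext_iff])]
      simp
  have h' := (α (n + 1 + 1)).toAlternatingMap.map_swap
    (Fin.cons X (Fin.cons Y v : Fin (n + 1) → V) : Fin (n + 1 + 1) → V) (i := 0) (j := 1) (by simp)
  rw [e] at h'
  exact h'

theorem gradeInv_interior (X : V) (α : AltForms V) :
    gradeInv (interior X α) = -interior X (gradeInv α) := by
  funext n
  ext v
  simp [gradeInv, interior_apply, pow_succ]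

theorem gradeInv_gradeInv (α : AltForms V) : gradeInv (gradeInv α) = α := by
  funext n
  simp [gradeInv, smul_smul, neg_one_pow_mul_self]

/-- All components of `α` have degrees of the parity of `k`. -/
def HasParity (k : ℕ) (α : AltForms V) : Prop := gradeInv α = (-1 : ℝ) ^ k • α

/-- Parity suffices for all signs, and `k + 1` stands for `k - 1` without truncated subtraction, so
`k = 0` needs no special treatment. -/
theorem HasParity.interior {k : ℕ} {α : AltForms V} (h : HasParity k α) (X : V) :
    HasParity (k + 1) (interior X α) := by
  rw [HasParity, gradeInv_interior, h, interior_smul_form, pow_succ, mul_neg_one]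
  exact (neg_smul _ _).symm

theorem hasParity_single {k : ℕ} (φ : V [⋀^Fin k]→L[ℝ] ℝ) :
    HasParity k (Pi.single k φ : AltForms V) := by
  funext n
  by_cases h : n = k
  · subst h
    simp [gradeInv]
  · simp [gradeInv, h]

theorem wedge_zero_apply (α β : AltForms V) (v : Fin 0 → V) : wedge α β 0 v = α 0 v * β 0 v := by
  rw [wedge_apply]
  simp [wedgeAt, rawWedge, Subsingleton.elim _ v]

/-- The basis of the inductions on the degree that prove graded commutativity and the Leibniz rule.
-/
theorem ext_interior {n : ℕ} {α β : AltForms V}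
    (h : ∀ X, interior X α n = interior X β n) : α (n + 1) = β (n + 1) := by
  ext v
  have := congrArg (fun γ => γ (Fin.tail v)) (h (v 0))
  simpa only [interior_apply, Fin.cons_self_tail] using this

/-- Inserting a vector lowers the degree and flips the parity of one factor, so induction applies to
both terms of the antiderivation rule. -/
theorem wedge_comm {k l : ℕ} {α β : AltForms V} (hα : HasParity k α) (hβ : HasParity l β) :
    wedge α β = (-1 : ℝ) ^ (k * l) • wedge β α := by
  funext n
  induction n generalizing α β k l with
  | zero =>
    ext v
    rw [Pi.smul_apply, ContinuousAlternatingMap.smul_apply, wedge_zero_apply, wedge_zero_apply]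
    have h0 := congrArg (fun γ : AltForms V => γ 0 v) hα
    simp only [gradeInv, pow_zero, one_smul, Pi.smul_apply,
      ContinuousAlternatingMap.smul_apply, smul_eq_mul] at h0
    -- For even `k` the sign is `1` and real multiplication commutes; for odd `k` the component `α
    -- 0` vanishes.
    rcases neg_one_pow_eq_or ℝ k with h | h
    · simp [pow_mul, h, mul_comm]
    · rw [h] at h0
      have : α 0 v = 0 := by linarith
      simp [this]
  | succ n ih =>
    refine ext_interior fun X => ?_
    rw [interior_smul_form, interior_wedge, interior_wedge, hα, hβ, wedge_smul_left,
      wedge_smul_left]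
    simp only [Pi.add_apply, Pi.smul_apply]
    rw [ih (hα.interior X) hβ, ih hα (hβ.interior X)]
    simp only [Pi.smul_apply, pow_mul, pow_succ]
    rcases neg_one_pow_eq_or ℝ k with h | h <;> rcases neg_one_pow_eq_or ℝ l with h' | h' <;>
      simp [h, h', add_comm, smul_smul]
    exact neg_one_smul ℝ (wedge (interior X β) α n)

/-- All components of `α` outside degree `d` vanish. -/
def HasDegree (d : ℤ) (α : AltForms V) : Prop := ∀ n : ℕ, (n : ℤ) ≠ d → α n = 0

theorem HasDegree.single_eq {n : ℕ} {α : AltForms V} (h : HasDegree n α) :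
    Pi.single n (α n) = α := by
  funext i
  by_cases hi : i = n
  · subst hi
    simp
  · rw [h i (by exact_mod_cast hi), Pi.single_eq_of_ne hi]

theorem hasDegree_single {k : ℕ} (φ : V [⋀^Fin k]→L[ℝ] ℝ) :
    HasDegree k (Pi.single k φ : AltForms V) := fun n hn =>
  Pi.single_eq_of_ne (by exact_mod_cast hn) _

/-- Degrees are integers so that the insertion into a form of degree `0` has degree `-1`, that is,
vanishes. -/
theorem HasDegree.interior {d : ℤ} {α : AltForms V} (h : HasDegree d α) (X : V) :
    HasDegree (d - 1) (interior X α) := fun n hn => by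
  ext v
  rw [interior_apply, h (n + 1) (by push_cast; omega)]
  rfl

theorem HasDegree.wedge {d e : ℤ} {α β : AltForms V} (hα : HasDegree d α) (hβ : HasDegree e β) :
    HasDegree (d + e) (wedge α β) := fun n hn => by
  ext v
  rw [wedge_apply]
  refine Finset.sum_eq_zero fun pq hpq => ?_
  have h := Finset.HasAntidiagonal.mem_antidiagonal.1 hpq
  rw [wedgeAt, dif_pos h]
  by_cases hp : (pq.1 : ℤ) = d
  · rw [hβ pq.2 (by omega)]
    simp [rawWedge]
  · rw [hα pq.1 hp]
    simp [rawWedge]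

theorem HasDegree.smul {d : ℤ} {α : AltForms V} (hα : HasDegree d α) (a : ℝ) :
    HasDegree d (a • α) := fun n hn => by simp [hα n hn]

theorem HasDegree.sub {d : ℤ} {α β : AltForms V} (hα : HasDegree d α) (hβ : HasDegree d β) :
    HasDegree d (α - β) := fun n hn => by simp [hα n hn, hβ n hn]

theorem HasDegree.sum {ι : Type*} {s : Finset ι} {d : ℤ} {α : ι → AltForms V}
    (hα : ∀ i ∈ s, HasDegree d (α i)) : HasDegree d (∑ i ∈ s, α i) := fun n hn => by
  rw [Finset.sum_apply]
  exact Finset.sum_eq_zero fun i hi => hα i hi n hn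

/-- The pullback of graded forms along a linear map. -/
def pullback (A : W →L[ℝ] V) : AltForms V →ₗ[ℝ] AltForms W where
  toFun α n := (α n).compContinuousLinearMap A
  map_add' _ _ := rfl
  map_smul' _ _ := rfl

theorem pullback_wedge (A : W →L[ℝ] V) (α β : AltForms V) :
    pullback A (wedge α β) = wedge (pullback A α) (pullback A β) := by
  funext n
  ext v
  change wedge α β n (A ∘ v) = _
  rw [wedge_apply, wedge_apply]
  rfl

theorem pullback_interior (A : W →L[ℝ] V) (X : W) (α : AltForms V) :
    pullback A (interior (A X) α) = interior X (pullback A α) := by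
  funext n
  ext v
  change α (n + 1) (Fin.cons (A X) (A ∘ v)) = α (n + 1) (A ∘ Fin.cons X v)
  rw [Fin.comp_cons]

theorem pullback_single (A : W →L[ℝ] V) (k : ℕ) (φ : V [⋀^Fin k]→L[ℝ] ℝ) :
    pullback A (Pi.single k φ) = Pi.single k (φ.compContinuousLinearMap A) := by
  funext n
  change ((Pi.single k φ : AltForms V) n).compContinuousLinearMap A = _
  by_cases h : n = k
  · subst h
    simp
  · rw [Pi.single_eq_of_ne h, Pi.single_eq_of_ne h]
    rfl

/-- A bilinear expression in a frame and its dual coframe does not depend on the frame. -/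
theorem sum_dual_frame {ι κ U : Type*} [Fintype ι] [Fintype κ] [AddCommGroup U] [Module ℝ U]
    {e : ι → V} {e' : ι → V →L[ℝ] ℝ} {f : κ → V} {f' : κ → V →L[ℝ] ℝ}
    (he : ∀ X, ∑ i, e' i X • e i = X) (hf : ∀ X, ∑ j, f' j X • f j = X)
    (T : (V →L[ℝ] ℝ) →ₗ[ℝ] V →ₗ[ℝ] U) : ∑ i, T (e' i) (e i) = ∑ j, T (f' j) (f j) := by
  -- Both sides are the value of `T` on the identity in `V* ⊗ V`. Expanding `e i` in the frame `f`,
  -- and `f' j` in the coframe `e'`, yields the same double sum.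
  have h1 : ∀ i, T (e' i) (e i) = ∑ j, f' j (e i) • T (e' i) (f j) := fun i => by
    conv_lhs => rw [← hf (e i)]
    rw [map_sum]
    simp only [map_smul]
  have h2 : ∀ j, f' j = ∑ i, f' j (e i) • e' i := fun j => by
    ext X
    conv_lhs => rw [← he X]
    simp [mul_comm]
  have h3 : ∀ j, T (f' j) (f j) = ∑ i, f' j (e i) • T (e' i) (f j) := fun j => by
    conv_lhs => rw [h2 j]
    rw [map_sum, LinearMap.sum_apply]
    simp only [map_smul, LinearMap.smul_apply]
  simp only [h1, h3]
  exact Finset.sum_comm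

end Algebra

/-! ### Exterior calculus of graded forms on a normed space. -/

section Calculus

variable {E : Type*} [NormedAddCommGroup E] [NormedSpace ℝ E]

theorem wedgeHom_apply_eq_rawWedge {p q n : ℕ} (h : p + q = n) (α : E [⋀^Fin p]→L[ℝ] ℝ)
    (β : E [⋀^Fin q]→L[ℝ] ℝ) (v : Fin n → E) :
    wedgeHom h α β v = ((p.factorial : ℝ) * (q.factorial : ℝ))⁻¹ * rawWedge h α β v :=
  wedgeHom_apply h α β v

theorem rawWedge_add_left {p q n : ℕ} (h : p + q = n) (α α' : E [⋀^Fin p]→L[ℝ] ℝ)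
    (β : E [⋀^Fin q]→L[ℝ] ℝ) (v : Fin n → E) :
    rawWedge h (α + α') β v = rawWedge h α β v + rawWedge h α' β v := by
  simp only [rawWedge, ContinuousAlternatingMap.add_apply, add_mul, smul_add,
    Finset.sum_add_distrib]

theorem rawWedge_add_right {p q n : ℕ} (h : p + q = n) (α : E [⋀^Fin p]→L[ℝ] ℝ)
    (β β' : E [⋀^Fin q]→L[ℝ] ℝ) (v : Fin n → E) :
    rawWedge h α (β + β') v = rawWedge h α β v + rawWedge h α β' v := by
  simp only [rawWedge, ContinuousAlternatingMap.add_apply, mul_add, smul_add,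
    Finset.sum_add_distrib]

theorem rawWedge_smul_right {p q n : ℕ} (h : p + q = n) (a : ℝ) (α : E [⋀^Fin p]→L[ℝ] ℝ)
    (β : E [⋀^Fin q]→L[ℝ] ℝ) (v : Fin n → E) :
    rawWedge h α (a • β) v = a * rawWedge h α β v := by
  simp only [rawWedge, Finset.mul_sum, ContinuousAlternatingMap.smul_apply, smul_eq_mul,
    mul_smul_comm, mul_left_comm]

theorem abs_rawWedge_le {p q n : ℕ} (h : p + q = n) (α : E [⋀^Fin p]→L[ℝ] ℝ)
    (β : E [⋀^Fin q]→L[ℝ] ℝ) (v : Fin n → E) :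
    |rawWedge h α β v| ≤ n.factorial * (‖α‖ * ‖β‖ * ∏ i, ‖v i‖) := by
  refine (Finset.abs_sum_le_sum_abs _ _).trans ?_
  have : ∀ σ : Equiv.Perm (Fin n), |Equiv.Perm.sign σ •
      (α (fun i => v (σ (Fin.cast h (Fin.castAdd q i)))) *
        β (fun i => v (σ (Fin.cast h (Fin.natAdd p i)))))| ≤ ‖α‖ * ‖β‖ * ∏ i, ‖v i‖ := by
    intro σ
    have h1 := α.le_opNorm fun i => v (σ (Fin.cast h (Fin.castAdd q i)))
    have h2 := β.le_opNorm fun i => v (σ (Fin.cast h (Fin.natAdd p i)))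
    have h3 : ∏ i, ‖v i‖ = (∏ i, ‖v (σ (Fin.cast h (Fin.castAdd q i)))‖) *
        ∏ i, ‖v (σ (Fin.cast h (Fin.natAdd p i)))‖ := by
      rw [← Equiv.prod_comp σ, ← Equiv.prod_comp (finCongr h), Fin.prod_univ_add]
      rfl
    have h4 : ∀ a : ℝ, |Equiv.Perm.sign σ • a| = |a| := fun a => by
      rcases Int.units_eq_one_or (Equiv.Perm.sign σ) with hs | hs <;> simp [hs]
    rw [h4, abs_mul, h3]
    refine (mul_le_mul h1 h2 (abs_nonneg _) (by positivity)).trans (le_of_eq ?_)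
    ring
  refine (Finset.sum_le_sum fun σ _ => this σ).trans (le_of_eq ?_)
  simp [Fintype.card_perm]

/-- The wedge product of forms of fixed degrees as a continuous bilinear map. -/
def wedgeHomL {p q n : ℕ} (h : p + q = n) :
    (E [⋀^Fin p]→L[ℝ] ℝ) →L[ℝ] (E [⋀^Fin q]→L[ℝ] ℝ) →L[ℝ] (E [⋀^Fin n]→L[ℝ] ℝ) :=
  LinearMap.mkContinuous₂ (LinearMap.mk₂ ℝ (wedgeHom h)
    (fun α α' β => by
      ext v
      simp only [wedgeHom_apply_eq_rawWedge, rawWedge_add_left, mul_add,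
        ContinuousAlternatingMap.add_apply])
    (fun a α β => by
      ext v
      simp only [wedgeHom_apply_eq_rawWedge, rawWedge_smul_left, mul_left_comm,
        ContinuousAlternatingMap.smul_apply, smul_eq_mul])
    (fun α β β' => by
      ext v
      simp only [wedgeHom_apply_eq_rawWedge, rawWedge_add_right, mul_add,
        ContinuousAlternatingMap.add_apply])
    (fun a α β => by
      ext v
      simp only [wedgeHom_apply_eq_rawWedge, rawWedge_smul_right, mul_left_comm,
        ContinuousAlternatingMap.smul_apply, smul_eq_mul]))
    -- Each of the `n!` permutations contributes at most `‖α‖ ‖β‖ ∏ ‖v i‖`.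
    (((p.factorial : ℝ) * (q.factorial : ℝ))⁻¹ * n.factorial) fun α β => by
      refine ContinuousAlternatingMap.opNorm_le_bound _ (by positivity) fun v => ?_
      rw [LinearMap.mk₂_apply, wedgeHom_apply_eq_rawWedge, norm_mul, Real.norm_eq_abs,
        abs_of_nonneg (by positivity), mul_assoc, mul_assoc, mul_assoc]
      refine mul_le_mul_of_nonneg_left ?_ (by positivity)
      refine (abs_rawWedge_le h α β v).trans (le_of_eq ?_)
      ring

/-- Insertion of a vector into a form of fixed degree as a continuous linear map. -/
def insertVecL (X : E) (n : ℕ) : (E [⋀^Fin (n + 1)]→L[ℝ] ℝ) →L[ℝ] (E [⋀^Fin n]→L[ℝ] ℝ) :=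
  (ContinuousLinearMap.apply ℝ (E [⋀^Fin n]→L[ℝ] ℝ) X).comp
    (ContinuousAlternatingMap.curryLeftLI (𝕜 := ℝ) (E := E) (F := ℝ)
      (n := n)).toContinuousLinearMap

theorem insertVecL_apply (X : E) {n : ℕ} (α : E [⋀^Fin (n + 1)]→L[ℝ] ℝ) :
    insertVecL X n α = insertVec X α := by
  ext v
  rw [insertVec_apply]
  rfl

/-- Differentiability at a point of all components of a graded form on a normed space. -/
def DiffAt (θ : E → AltForms E) (y : E) : Prop :=
  ∀ n, DifferentiableAt ℝ (fun z => θ z n) y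

/-- The directional derivative of a graded form. -/
def partialD (θ : E → AltForms E) (y X : E) : AltForms E := fun n =>
  fderiv ℝ (fun z => θ z n) y X

/-- The exterior derivative of a graded form on a normed space. -/
def localD (θ : E → AltForms E) (y : E) : AltForms E := fun n =>
  match n with
  | 0 => 0
  | n + 1 => extDeriv (fun z => θ z n) y

theorem extDeriv_zero_form {n : ℕ} (y : E) :
    extDeriv (fun _ => (0 : E [⋀^Fin n]→L[ℝ] ℝ)) y = 0 := by
  have h := extDeriv_smul (0 : ℝ) (fun _ : E => (0 : E [⋀^Fin n]→L[ℝ] ℝ)) (x := y)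
  rw [zero_smul, zero_smul] at h
  exact h

variable {θ η : E → AltForms E} {y : E}

theorem DiffAt.interior (h : DiffAt θ y) (X : E) :
    DiffAt (fun z => interior X (θ z)) y := fun n => by
  simp only [interior_eq_insertVec, ← insertVecL_apply]
  exact (insertVecL X n).differentiableAt.comp y (h (n + 1))

theorem DiffAt.gradeInv (h : DiffAt θ y) : DiffAt (fun z => gradeInv (θ z)) y := fun n =>
  (h n).const_smul ((-1 : ℝ) ^ n)

theorem DiffAt.const_smul (h : DiffAt θ y) (a : ℝ) : DiffAt (fun z => a • θ z) y := fun n =>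
  DifferentiableAt.const_smul (h n) a

theorem DiffAt.sum {ι : Type*} {s : Finset ι} {θ : ι → E → AltForms E}
    (h : ∀ i ∈ s, DiffAt (θ i) y) : DiffAt (fun z => ∑ i ∈ s, θ i z) y := fun n => by
  simp only [Finset.sum_apply]
  exact DifferentiableAt.fun_sum fun i hi => h i hi n

theorem hasFDerivAt_wedge (hθ : DiffAt θ y) (hη : DiffAt η y) (n : ℕ) :
    HasFDerivAt (fun z => wedge (θ z) (η z) n)
      (∑ pq : Finset.HasAntidiagonal.antidiagonal n,
        ((wedgeHomL (Finset.HasAntidiagonal.mem_antidiagonal.1 pq.2)).precompR E (θ y pq.1.1)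
          (fderiv ℝ (fun z => η z pq.1.2) y) +
        (wedgeHomL (Finset.HasAntidiagonal.mem_antidiagonal.1 pq.2)).precompL E
          (fderiv ℝ (fun z => θ z pq.1.1) y) (η y pq.1.2))) y := by
  unfold wedge
  refine HasFDerivAt.fun_sum fun pq _ => ?_
  exact ContinuousLinearMap.hasFDerivAt_of_bilinear
    (wedgeHomL (Finset.HasAntidiagonal.mem_antidiagonal.1 pq.2)) (hθ pq.1.1).hasFDerivAt
      (hη pq.1.2).hasFDerivAt

theorem DiffAt.wedge (hθ : DiffAt θ y) (hη : DiffAt η y) :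
    DiffAt (fun z => wedge (θ z) (η z)) y := fun n =>
  (hasFDerivAt_wedge hθ hη n).differentiableAt

theorem partialD_wedge (hθ : DiffAt θ y) (hη : DiffAt η y) (X : E) :
    partialD (fun z => wedge (θ z) (η z)) y X =
      wedge (partialD θ y X) (η y) + wedge (θ y) (partialD η y X) := by
  funext n
  rw [partialD, (hasFDerivAt_wedge hθ hη n).fderiv, add_comm]
  simp only [sum_apply, Pi.add_apply, add_apply,
    Finset.sum_add_distrib]
  rfl

theorem partialD_interior (hθ : DiffAt θ y) (X Y : E) :
    partialD (fun z => interior X (θ z)) y Y = interior X (partialD θ y Y) := by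
  funext n
  simp only [partialD, interior_eq_insertVec, ← insertVecL_apply]
  exact congrArg (fun f => f Y)
    ((insertVecL X n).hasFDerivAt.comp y (hθ (n + 1)).hasFDerivAt).fderiv

theorem partialD_const_smul (hθ : DiffAt θ y) (a : ℝ) (X : E) :
    partialD (fun z => a • θ z) y X = a • partialD θ y X := by
  funext n
  exact congrArg (fun f => f X) (fderiv_fun_const_smul (hθ n) a)

theorem partialD_gradeInv (hθ : DiffAt θ y) (X : E) :
    partialD (fun z => gradeInv (θ z)) y X = gradeInv (partialD θ y X) := by
  funext n
  exact congrArg (fun f => f X) (fderiv_fun_const_smul (hθ n) ((-1 : ℝ) ^ n))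

theorem localD_const_smul (a : ℝ) : localD (fun z => a • θ z) y = a • localD θ y := by
  funext n
  cases n with
  | zero => exact (smul_zero a).symm
  | succ n => exact extDeriv_smul a fun z => θ z n

theorem localD_sum {ι : Type*} (s : Finset ι) {θ : ι → E → AltForms E}
    (h : ∀ i ∈ s, DiffAt (θ i) y) :
    localD (fun z => ∑ i ∈ s, θ i z) y = ∑ i ∈ s, localD (θ i) y := by
  classical
  funext n
  rw [Finset.sum_apply]
  cases n with
  | zero => exact (Finset.sum_const_zero).symm
  | succ n =>
    simp only [localD, Finset.sum_apply]
    induction s using Finset.induction_on with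
    | empty =>
      simp only [Finset.sum_empty]
      exact extDeriv_zero_form y
    | insert i s hi ih =>
      simp only [Finset.sum_insert hi]
      rw [← ih fun j hj => h j (Finset.mem_insert_of_mem hj)]
      exact extDeriv_fun_add (h i (Finset.mem_insert_self i s) n)
        (DifferentiableAt.fun_sum fun j hj => h j (Finset.mem_insert_of_mem hj) n)

theorem localD_add (hθ : DiffAt θ y) (hη : DiffAt η y) :
    localD (fun z => θ z + η z) y = localD θ y + localD η y := by
  funext n
  cases n with
  | zero => exact (add_zero _).symm
  | succ n => exact extDeriv_fun_add (hθ n) (hη n)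

theorem localD_gradeInv : localD (fun z => gradeInv (θ z)) y = -gradeInv (localD θ y) := by
  funext n
  cases n with
  | zero => simp [localD, gradeInv]
  | succ n =>
    refine (extDeriv_smul ((-1 : ℝ) ^ n) fun z => θ z n).trans ?_
    simp only [gradeInv, localD, pow_succ, mul_neg_one, Pi.neg_apply]
    ext v
    simp

/-- Cartan's formula for a constant vector field. -/
theorem interior_localD (hθ : DiffAt θ y) (X : E) :
    interior X (localD θ y) =
      partialD θ y X - localD (fun z => interior X (θ z)) y := by
  funext n
  ext v
  rw [interior_apply, Pi.sub_apply, ContinuousAlternatingMap.sub_apply]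
  simp only [localD, partialD, extDeriv]
  -- The summand of index `0` differentiates in the direction `X`. In the others `X` remains an
  -- argument, and the index shift by one produces the minus sign.
  rw [ContinuousAlternatingMap.alternatizeUncurryFin_apply, Fin.sum_univ_succ]
  cases n with
  | zero =>
    simp
  | succ n =>
    simp only [ContinuousAlternatingMap.alternatizeUncurryFin_apply]
    have h0 : (Fin.removeNth 0 (Fin.cons X v : Fin (n + 2) → E)) = v := by
      ext i; simp [Fin.removeNth]
    have hs : ∀ i : Fin (n + 1), Fin.removeNth i.succ (Fin.cons X v : Fin (n + 2) → E) =
        Fin.cons X (i.removeNth v) := by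
      intro i
      ext j
      refine Fin.cases ?_ (fun j => ?_) j <;> simp [Fin.removeNth]
    have hd : ∀ Y : E, fderiv ℝ (fun z => interior X (θ z) n) y Y =
        interior X (partialD θ y Y) n := fun Y =>
      congrFun (partialD_interior hθ X Y) n
    simp only [h0, hs, hd, Fin.cons_zero, Fin.cons_succ, Fin.val_zero, pow_zero, one_smul,
      Fin.val_succ, interior_apply, partialD]
    rw [sub_eq_add_neg, ← Finset.sum_neg_distrib]
    congr 1
    refine Finset.sum_congr rfl fun i _ => ?_
    simp [pow_succ]

/-- The Leibniz rule for the exterior derivative. -/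
theorem localD_wedge (hθ : DiffAt θ y) (hη : DiffAt η y) :
    localD (fun z => wedge (θ z) (η z)) y =
      wedge (localD θ y) (η y) + wedge (gradeInv (θ y)) (localD η y) := by
  funext n
  induction n generalizing θ η with
  | zero =>
    ext v
    rw [Pi.add_apply, ContinuousAlternatingMap.add_apply, wedge_zero_apply, wedge_zero_apply]
    simp [localD]
  | succ n ih =>
    -- After insertion of `X`, Cartan's formula leaves `∂_X`, which obeys the product rule, and `d`
    -- of wedge products in one degree lower, to which the induction hypothesis applies.
    refine ext_interior fun X => ?_
    rw [interior_localD (hθ.wedge hη), partialD_wedge hθ hη]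
    simp only [interior_wedge]
    rw [localD_add ((hθ.interior X).wedge hη) (hθ.gradeInv.wedge (hη.interior X))]
    rw [interior_add_form, interior_wedge, interior_wedge, gradeInv_gradeInv,
      interior_localD hθ, interior_localD hη]
    simp only [Pi.add_apply, Pi.sub_apply]
    rw [ih (hθ.interior X) hη, ih hθ.gradeInv (hη.interior X), localD_gradeInv,
      gradeInv_gradeInv, gradeInv_interior]
    simp only [wedge_sub_left, wedge_sub_right, wedge_neg_left, Pi.add_apply,
      Pi.sub_apply, Pi.neg_apply]
    abel

theorem HasParity.localD {k : ℕ} (h : ∀ z, HasParity k (θ z)) :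
    HasParity (k + 1) (localD θ y) := by
  have := localD_gradeInv (θ := θ) (y := y)
  have e : (fun z => FrolicherNijenhuis.gradeInv (θ z)) = fun z => (-1 : ℝ) ^ k • θ z := funext h
  rw [e] at this
  rw [localD_const_smul] at this
  rw [HasParity, ← neg_neg (FrolicherNijenhuis.gradeInv _), ← this, pow_succ, mul_neg_one]
  exact (neg_smul _ _).symm

theorem HasParity.partialD {k : ℕ} (h : ∀ z, HasParity k (θ z)) (hθ : DiffAt θ y) (X : E) :
    HasParity k (partialD θ y X) := by
  have := partialD_gradeInv hθ X
  have e : (fun z => FrolicherNijenhuis.gradeInv (θ z)) = fun z => (-1 : ℝ) ^ k • θ z := funext h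
  rw [e] at this
  rw [HasParity, ← this, partialD_const_smul hθ]

theorem HasDegree.localD {d : ℤ} (h : ∀ z, HasDegree d (θ z)) :
    HasDegree (d + 1) (localD θ y) := fun n hn => by
  cases n with
  | zero => rfl
  | succ n =>
    have : ∀ z, θ z n = 0 := fun z => h z n (by push_cast at hn; omega)
    simp only [FrolicherNijenhuis.localD, this]
    exact extDeriv_zero_form y

end Calculus

/-! ### The identity in coordinates with constant frame. -/

section Coordinates

variable {E : Type*} [NormedAddCommGroup E] [NormedSpace ℝ E] {y : E}

theorem neg_smul_form (a : ℝ) (α : AltForms E) : -a • α = -(a • α) := neg_smul a α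

/-- The difference between `i_X Θ(κ ⊗ Y) μ` and the part of it that comes from `Θ(κ ⊗ Y) i_X μ`,
where `X` and `Y` are constant and `κ` is of degree `k`. -/
def contractionDefect (k : ℕ) (κ μ : E → AltForms E) (X Y y : E) : AltForms E :=
  wedge (interior X (κ y)) (interior Y (localD μ y)) +
    (-1 : ℝ) ^ k • wedge (partialD κ y X) (interior Y (μ y)) -
    (-1 : ℝ) ^ k • localD (fun z => wedge (interior X (κ z)) (interior Y (μ z))) y

/-- The identity for the part of `i_X [κ ⊗ Y, μ ⊗ X]` coming from `Θ(κ ⊗ Y) μ`, where `X` and `Y`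
are constant. -/
theorem interior_lieDeriv_decomposable {k : ℕ} {κ μ : E → AltForms E}
    (hκ : DiffAt κ y) (hμ : DiffAt μ y) (pκ : ∀ z, HasParity k (κ z)) (X Y : E) :
    interior X (wedge (κ y) (interior Y (localD μ y)) +
        (-1 : ℝ) ^ k • localD (fun z => wedge (κ z) (interior Y (μ z))) y) =
      (-1 : ℝ) ^ k • wedge (κ y) (interior Y (localD (fun z => interior X (μ z)) y)) +
      localD (fun z => wedge (κ z) (interior Y (interior X (μ z)))) y +
      contractionDefect k κ μ X Y y := by
  unfold contractionDefect
  have e : (fun z => interior X (wedge (κ z) (interior Y (μ z)))) = fun z =>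
      wedge (interior X (κ z)) (interior Y (μ z)) +
        -((-1 : ℝ) ^ k) • wedge (κ z) (interior Y (interior X (μ z))) := by
    funext z
    rw [interior_wedge, pκ z, wedge_smul_left, interior_interior_swap X Y, wedge_neg_right,
      smul_neg, neg_smul_form]
  rw [interior_add_form, interior_smul_form, interior_wedge, pκ y, wedge_smul_left,
    interior_interior_swap X Y, interior_localD (hκ.wedge (hμ.interior Y)) X, e,
    localD_add ((hκ.interior X).wedge (hμ.interior Y))
      ((hκ.wedge ((hμ.interior X).interior Y)).const_smul _), localD_const_smul,
    partialD_wedge hκ (hμ.interior Y), partialD_interior hμ, interior_localD hμ X,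
    interior_sub_form, wedge_neg_right, wedge_sub_right]
  -- The two terms in `κ ∧ i_Y ∂_X μ`, one from Cartan's formula for `μ` and one from the product
  -- rule, cancel.
  rcases neg_one_pow_eq_or ℝ k with h | h <;> rw [h] <;> module

/-- Once the factors are commuted, the two exact terms are equal and give `-2 (-1)^k d(i_X κ ∧ i_Y
μ)`. By the Leibniz rule and Cartan's formula the four other terms add up to `(-1)^k d(i_X κ ∧ i_Y
μ)`. -/
theorem contractionDefect_comm {k l : ℕ} {κ μ : E → AltForms E}
    (hκ : DiffAt κ y) (hμ : DiffAt μ y) (pκ : ∀ z, HasParity k (κ z))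
    (pμ : ∀ z, HasParity l (μ z)) (X Y : E) :
    contractionDefect k κ μ X Y y - (-1 : ℝ) ^ (k * l) • contractionDefect l μ κ Y X y =
      -((-1 : ℝ) ^ k • localD (fun z => wedge (interior X (κ z)) (interior Y (μ z))) y) := by
  unfold contractionDefect
  have c1 := wedge_comm ((pμ y).interior Y) ((HasParity.localD pκ (y := y)).interior X)
  have c2 := wedge_comm (HasParity.partialD pμ hμ Y) ((pκ y).interior X)
  have c3 : (fun z => wedge (interior Y (μ z)) (interior X (κ z))) = fun z =>
      (-1 : ℝ) ^ ((l + 1) * (k + 1)) • wedge (interior X (κ z)) (interior Y (μ z)) :=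
    funext fun z => wedge_comm ((pμ z).interior Y) ((pκ z).interior X)
  rw [c1, c2, c3, localD_const_smul, localD_wedge (hκ.interior X) (hμ.interior Y),
    (pκ y).interior X, wedge_smul_left, interior_localD hκ X]
  have d1 : localD (fun z => interior X (κ z)) y =
      partialD κ y X - interior X (localD κ y) := by
    rw [interior_localD hκ X]
    abel
  have d2 : localD (fun z => interior Y (μ z)) y =
      partialD μ y Y - interior Y (localD μ y) := by
    rw [interior_localD hμ Y]
    abel
  simp only [wedge_sub_left, wedge_sub_right, d2]
  simp only [pow_mul, pow_succ]
  rcases neg_one_pow_eq_or ℝ k with h | h <;> rcases neg_one_pow_eq_or ℝ l with h' | h' <;>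
    simp only [h, h', one_pow, mul_one, mul_neg, neg_neg] <;> module

variable {m : ℕ}

/-- The insertion operator of `∑ⱼ κⱼ ⊗ eⱼ`, where the `eⱼ` are constant. -/
def localInsertion (e : Fin m → E) (κ : Fin m → E → AltForms E) (θ : E → AltForms E) :
    E → AltForms E := fun z => ∑ a, wedge (κ a z) (interior (e a) (θ z))

/-- The contraction of `∑ⱼ κⱼ ⊗ eⱼ`, where the `eⱼ` are constant. -/
def localContraction (e : Fin m → E) (κ : Fin m → E → AltForms E) : E → AltForms E :=
  fun z => ∑ a, interior (e a) (κ a z)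

/-- The concomitant of `∑ⱼ κⱼ ⊗ eⱼ` and `∑ⱼ μⱼ ⊗ eⱼ`, where the `eⱼ` are constant. -/
def localConcomitant (e : Fin m → E) (κ μ : Fin m → E → AltForms E) : E → AltForms E :=
  fun z => ∑ i, ∑ j, wedge (interior (e j) (κ i z)) (interior (e i) (μ j z))

/-- The Lie derivative along `∑ⱼ κⱼ ⊗ eⱼ`, where the `eⱼ` are constant and the `κⱼ` are of
degree `k`. -/
def localLieDeriv (k : ℕ) (e : Fin m → E) (κ : Fin m → E → AltForms E) (θ : E → AltForms E) :
    E → AltForms E := fun z =>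
  localInsertion e κ (localD θ) z - (-1 : ℝ) ^ (k + 1) • localD (localInsertion e κ θ) z

variable {κ μ : Fin m → E → AltForms E}

theorem sum_interior_localLieDeriv {k : ℕ} (e : Fin m → E) (hκ : ∀ a, DiffAt (κ a) y)
    (hμ : ∀ a, DiffAt (μ a) y) (pκ : ∀ a z, HasParity k (κ a z)) :
    ∑ j, interior (e j) (localLieDeriv k e κ (μ j) y) =
      (-1 : ℝ) ^ k • localLieDeriv k e κ (localContraction e μ) y +
      ∑ a, ∑ j, contractionDefect k (κ a) (μ j) (e j) (e a) y := by
  have h1 : ∀ j, interior (e j) (localLieDeriv k e κ (μ j) y) =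
      ∑ a, interior (e j) (wedge (κ a y) (interior (e a) (localD (μ j) y)) +
        (-1 : ℝ) ^ k • localD (fun z => wedge (κ a z) (interior (e a) (μ j z))) y) := by
    intro j
    unfold localLieDeriv localInsertion
    rw [localD_sum _ fun a _ => (hκ a).wedge ((hμ j).interior (e a)), ← interior_sum_form,
      Finset.sum_add_distrib, ← Finset.smul_sum, pow_succ, mul_neg_one, neg_smul_form,
      sub_neg_eq_add]
  have h2 : (-1 : ℝ) ^ k • localLieDeriv k e κ (localContraction e μ) y =
      ∑ a, ∑ j, ((-1 : ℝ) ^ k • wedge (κ a y) (interior (e a)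
        (localD (fun z => interior (e j) (μ j z)) y)) +
      localD (fun z => wedge (κ a z) (interior (e a) (interior (e j) (μ j z)))) y) := by
    unfold localLieDeriv localInsertion localContraction
    rw [localD_sum _ fun a _ => (hμ a).interior (e a)]
    simp only [interior_sum_form, wedge_sum_right]
    rw [localD_sum _ fun a _ => DiffAt.sum fun j _ =>
      (hκ a).wedge (((hμ j).interior (e j)).interior (e a))]
    simp only [fun a => localD_sum (y := y) Finset.univ fun j _ =>
      (hκ a).wedge (((hμ j).interior (e j)).interior (e a))]
    simp only [Finset.sum_add_distrib, ← Finset.smul_sum]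
    rw [pow_succ, mul_neg_one, neg_smul_form, sub_neg_eq_add, smul_add, smul_smul,
      neg_one_pow_mul_self, one_smul]
  rw [Finset.sum_congr rfl fun j _ => h1 j, Finset.sum_comm, h2, ← Finset.sum_add_distrib]
  refine Finset.sum_congr rfl fun a _ => ?_
  rw [← Finset.sum_add_distrib]
  exact Finset.sum_congr rfl fun j _ =>
    interior_lieDeriv_decomposable (hκ a) (hμ j) (pκ a) (e j) (e a)

/-- The coordinate version of the theorem. The sign `(-1)^(kl + l)` is the `(-1)^(kl)` of the
commutator times the `(-1)^l` from moving `i_X` past `Θ(L)`. -/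
theorem sum_interior_bracket {k l : ℕ} (e : Fin m → E) (hκ : ∀ a, DiffAt (κ a) y)
    (hμ : ∀ a, DiffAt (μ a) y) (pκ : ∀ a z, HasParity k (κ a z))
    (pμ : ∀ a z, HasParity l (μ a z)) :
    ∑ j, interior (e j) (localLieDeriv k e κ (μ j) y -
        (-1 : ℝ) ^ (k * l) • localLieDeriv l e μ (κ j) y) =
      (-1 : ℝ) ^ k • localLieDeriv k e κ (localContraction e μ) y -
        (-1 : ℝ) ^ (k * l + l) • localLieDeriv l e μ (localContraction e κ) y -
        (-1 : ℝ) ^ k • localD (localConcomitant e κ μ) y := by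
  simp only [interior_sub_form, interior_smul_form, Finset.sum_sub_distrib, ← Finset.smul_sum]
  rw [sum_interior_localLieDeriv e hκ hμ pκ, sum_interior_localLieDeriv e hμ hκ pμ]
  have h : localD (localConcomitant e κ μ) y = ∑ a, ∑ j, localD (fun z =>
      wedge (interior (e j) (κ a z)) (interior (e a) (μ j z))) y := by
    unfold localConcomitant
    rw [localD_sum _ fun a _ => DiffAt.sum fun j _ =>
      ((hκ a).interior (e j)).wedge ((hμ j).interior (e a))]
    exact Finset.sum_congr rfl fun a _ => localD_sum _ fun j _ =>
      ((hκ a).interior (e j)).wedge ((hμ j).interior (e a))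
  have h' : (∑ a, ∑ j, contractionDefect k (κ a) (μ j) (e j) (e a) y) -
      (-1 : ℝ) ^ (k * l) • ∑ a, ∑ j, contractionDefect l (μ a) (κ j) (e j) (e a) y =
      -((-1 : ℝ) ^ k • localD (localConcomitant e κ μ) y) := by
    -- The indices are exchanged in the second sum so that the defects pair off with `X` and `Y`
    -- swapped.
    rw [h, Finset.sum_comm (f := fun a j => contractionDefect l (μ a) (κ j) (e j) (e a) y)]
    simp only [Finset.smul_sum, ← Finset.sum_sub_distrib, ← Finset.sum_neg_distrib]
    exact Finset.sum_congr rfl fun a _ => Finset.sum_congr rfl fun j _ =>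
      contractionDefect_comm (hκ a) (hμ j) (pκ a) (pμ j) (e j) (e a)
  rw [smul_add, add_sub_add_comm, h', smul_smul, ← pow_add]
  abel

end Coordinates

/-! ### Changes of frame, and wedge products with functions. -/

section Frames

variable {V W : Type*} [AddCommGroup V] [Module ℝ V] [TopologicalSpace V]
  [AddCommGroup W] [Module ℝ W] [TopologicalSpace W]

/-- The graded form `φ ∘ K` of a vector valued form `K`, as a linear function of `φ`. -/
def covectorComp {k : ℕ} (K : V [⋀^Fin k]→L[ℝ] V) : (V →L[ℝ] ℝ) →ₗ[ℝ] AltForms V where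
  toFun φ := Pi.single k (φ.compContinuousAlternatingMap K)
  map_add' φ ψ := by
    rw [← Pi.single_add]
    rfl
  map_smul' a φ := by
    rw [RingHom.id_apply, ← Pi.single_smul]
    rfl

variable {ι κ : Type*} [Fintype ι] [Fintype κ] {e : ι → V} {e' : ι → V →L[ℝ] ℝ} {f : κ → V}
  {f' : κ → V →L[ℝ] ℝ}

theorem sum_wedge_interior_frame (he : ∀ X, ∑ i, e' i X • e i = X)
    (hf : ∀ X, ∑ j, f' j X • f j = X) {k : ℕ} (K : V [⋀^Fin k]→L[ℝ] V) (η : AltForms V) :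
    ∑ i, wedge (covectorComp K (e' i)) (interior (e i) η) =
      ∑ j, wedge (covectorComp K (f' j)) (interior (f j) η) :=
  sum_dual_frame he hf (wedgeL.compl₁₂ (covectorComp K) (interiorL.flip η))

theorem sum_interior_frame (he : ∀ X, ∑ i, e' i X • e i = X)
    (hf : ∀ X, ∑ j, f' j X • f j = X) {k : ℕ} (K : V [⋀^Fin k]→L[ℝ] V) :
    ∑ i, interior (e i) (covectorComp K (e' i)) = ∑ j, interior (f j) (covectorComp K (f' j)) :=
  sum_dual_frame he hf (interiorL.flip.comp (covectorComp K))

/-- A double trace: for fixed `j` the sum over `i` changes frame, then the sum over `j` for fixed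
`i`. -/
theorem sum_sum_wedge_frame (he : ∀ X, ∑ i, e' i X • e i = X)
    (hf : ∀ X, ∑ j, f' j X • f j = X) {k l : ℕ} (K : V [⋀^Fin k]→L[ℝ] V)
    (L : V [⋀^Fin l]→L[ℝ] V) :
    ∑ i, ∑ j, wedge (interior (e j) (covectorComp K (e' i)))
        (interior (e i) (covectorComp L (e' j))) =
      ∑ i, ∑ j, wedge (interior (f j) (covectorComp K (f' i)))
        (interior (f i) (covectorComp L (f' j))) := by
  have h1 : ∀ j, ∑ i, wedge (interior (e j) (covectorComp K (e' i)))
        (interior (e i) (covectorComp L (e' j))) =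
      ∑ i, wedge (interior (e j) (covectorComp K (f' i)))
        (interior (f i) (covectorComp L (e' j))) := fun j =>
    sum_dual_frame he hf (wedgeL.compl₁₂ ((interiorL (e j)).comp (covectorComp K))
      (interiorL.flip (covectorComp L (e' j))))
  have h2 : ∀ i, ∑ j, wedge (interior (e j) (covectorComp K (f' i)))
        (interior (f i) (covectorComp L (e' j))) =
      ∑ j, wedge (interior (f j) (covectorComp K (f' i)))
        (interior (f i) (covectorComp L (f' j))) := fun i =>
    sum_dual_frame he hf (wedgeL.compl₁₂ (interiorL.flip (covectorComp K (f' i)))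
      ((interiorL (f i)).comp (covectorComp L))).flip
  rw [Finset.sum_comm, Finset.sum_congr rfl fun j _ => h1 j, Finset.sum_comm,
    Finset.sum_congr rfl fun i _ => h2 i]

theorem interior_single_zero (X : V) (α : V [⋀^Fin 0]→L[ℝ] ℝ) :
    interior X (Pi.single 0 α : AltForms V) = 0 := by
  funext n
  ext v
  simp [interior_apply]

theorem rawWedge_zero_right {n : ℕ} (h : n + 0 = n) (α : V [⋀^Fin n]→L[ℝ] ℝ)
    (β : V [⋀^Fin 0]→L[ℝ] ℝ) (v : Fin n → V) :
    rawWedge h α β v = n.factorial * (β 0 * α v) := by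
  have : ∀ σ : Equiv.Perm (Fin n), Equiv.Perm.sign σ •
      (α (fun i => v (σ (Fin.cast h (Fin.castAdd 0 i)))) *
        β (fun i => v (σ (Fin.cast h (Fin.natAdd n i))))) = β 0 * α v := by
    intro σ
    have h1 := α.toAlternatingMap.map_perm v σ
    have h2 : α (fun i => v (σ (Fin.cast h (Fin.castAdd 0 i)))) =
        Equiv.Perm.sign σ • α v := h1
    rw [h2, Subsingleton.elim (fun i => v (σ (Fin.cast h (Fin.natAdd n i)))) 0]
    rcases Int.units_eq_one_or (Equiv.Perm.sign σ) with hs | hs <;> simp [hs, mul_comm]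
  rw [rawWedge, Finset.sum_congr rfl fun σ _ => this σ]
  simp [Fintype.card_perm]

theorem wedge_single_zero (α : AltForms V) (β : V [⋀^Fin 0]→L[ℝ] ℝ) :
    wedge α (Pi.single 0 β) = β 0 • α := by
  funext n
  ext v
  rw [wedge_apply, Finset.sum_eq_single (n, 0)]
  · rw [wedgeAt, dif_pos (add_zero n)]
    simp only
    rw [rawWedge_zero_right]
    have := Nat.factorial_ne_zero n
    simp
    field_simp
  · rintro ⟨p, q⟩ hpq hne
    have h := Finset.HasAntidiagonal.mem_antidiagonal.1 hpq
    have hq : q ≠ 0 := by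
      rintro rfl
      exact hne (by simpa using h)
    simp [wedgeAt, hq, rawWedge]
  · intro h
    exact absurd (Finset.HasAntidiagonal.mem_antidiagonal.2 (add_zero n)) h

end Frames

/-! ### Locality and degrees of the coordinate operators. -/

section Local

variable {E : Type*} [NormedAddCommGroup E] [NormedSpace ℝ E] {m : ℕ} {y : E}

open Topology in
theorem localD_congr {θ η : E → AltForms E} (h : θ =ᶠ[𝓝 y] η) : localD θ y = localD η y := by
  funext n
  cases n with
  | zero => rfl
  | succ n =>
    have : (fun z => θ z n) =ᶠ[𝓝 y] fun z => η z n := h.mono fun z hz => congrFun hz n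
    exact this.extDeriv_eq

open Topology in
theorem localLieDeriv_congr (k : ℕ) (e : Fin m → E) (κ : Fin m → E → AltForms E)
    {θ η : E → AltForms E} (h : θ =ᶠ[𝓝 y] η) :
    localLieDeriv k e κ θ y = localLieDeriv k e κ η y := by
  have h' : localInsertion e κ θ =ᶠ[𝓝 y] localInsertion e κ η := h.mono fun z hz => by
    simp only [localInsertion, hz]
  rw [localLieDeriv, localLieDeriv, localD_congr h', localInsertion, localInsertion,
    localD_congr h]

theorem HasDegree.localInsertion {k d : ℤ} (e : Fin m → E) {κ : Fin m → E → AltForms E}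
    (hκ : ∀ a z, HasDegree k (κ a z)) {α : E → AltForms E} {z : E} (hα : HasDegree d (α z)) :
    HasDegree (k + d - 1) (localInsertion e κ α z) :=
  HasDegree.sum fun a _ => by
    rw [add_sub_assoc]
    exact (hκ a z).wedge (hα.interior (e a))

theorem HasDegree.localLieDeriv {k d : ℕ} (e : Fin m → E) {κ : Fin m → E → AltForms E}
    (hκ : ∀ a z, HasDegree k (κ a z)) {θ : E → AltForms E} (hθ : ∀ z, HasDegree d (θ z)) :
    HasDegree (k + d) (localLieDeriv k e κ θ y) := by
  have h1 := HasDegree.localInsertion e hκ (HasDegree.localD hθ (y := y))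
  have h2 := HasDegree.localD (fun z => HasDegree.localInsertion e hκ (hθ z)) (y := y)
  rw [← add_assoc, add_sub_cancel_right] at h1
  rw [sub_add_cancel] at h2
  exact h1.sub (h2.smul _)

end Local

/-! ### Algebraic operators read in one chart. -/

section Charts

variable {m : ℕ} {M : Type*} [TopologicalSpace M] [ChartedSpace (EuclideanSpace ℝ (Fin m)) M]

/-- The derivative of the inverse of the chart at `x`, at a point `y` of the chart. -/
def chartFrame (x : M) (y : EuclideanSpace ℝ (Fin m)) :
    EuclideanSpace ℝ (Fin m) →L[ℝ] TangentSpace (𝓡 m) ((extChartAt (𝓡 m) x).symm y) :=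
  mfderiv 𝓘(ℝ, EuclideanSpace ℝ (Fin m)) (𝓡 m) (extChartAt (𝓡 m) x).symm y

/-- The derivative of the chart at `x`, at a point `p` of the manifold. -/
def chartDeriv (x p : M) : TangentSpace (𝓡 m) p →L[ℝ] EuclideanSpace ℝ (Fin m) :=
  mfderiv (𝓡 m) 𝓘(ℝ, EuclideanSpace ℝ (Fin m)) (extChartAt (𝓡 m) x) p

/-- The expression of a graded form in the chart at `x`. -/
def localForm (x : M) (η : Forms m M) (y : EuclideanSpace ℝ (Fin m)) :
    AltForms (EuclideanSpace ℝ (Fin m)) := fun n => inChart x n η y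

/-- The components in the chart at `x` of a vector valued form. -/
def localComponent (x : M) {k : ℕ} (K : VectorForms m M k) (j : Fin m)
    (y : EuclideanSpace ℝ (Fin m)) : AltForms (EuclideanSpace ℝ (Fin m)) :=
  Pi.single k ((EuclideanSpace.proj j : EuclideanSpace ℝ (Fin m) →L[ℝ] ℝ).compContinuousAlternatingMap
    (vectorInChart x K y))

/-- The vectors of the standard basis of `ℝᵐ`. -/
def stdFrame (m : ℕ) (j : Fin m) : EuclideanSpace ℝ (Fin m) := EuclideanSpace.single j 1

theorem sum_proj_smul_stdFrame (w : EuclideanSpace ℝ (Fin m)) :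
    ∑ j, w j • stdFrame m j = w := by
  simpa [stdFrame] using (EuclideanSpace.basisFun (Fin m) ℝ).sum_repr w

theorem localForm_eq (x : M) (η : Forms m M) (y : EuclideanSpace ℝ (Fin m)) :
    localForm x η y = pullback (chartFrame x y) (η ((extChartAt (𝓡 m) x).symm y)) := rfl

theorem localComponent_hasParity (x : M) {k : ℕ} (K : VectorForms m M k) (j : Fin m)
    (y : EuclideanSpace ℝ (Fin m)) : HasParity k (localComponent x K j y) := hasParity_single _

theorem localComponent_hasDegree (x : M) {k : ℕ} (K : VectorForms m M k) (j : Fin m)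
    (y : EuclideanSpace ℝ (Fin m)) : HasDegree k (localComponent x K j y) := hasDegree_single _

theorem pullback_covectorComp (x : M) {k : ℕ} (K : VectorForms m M k) (j : Fin m)
    (y : EuclideanSpace ℝ (Fin m)) :
    pullback (chartFrame x y) (covectorComp (K ((extChartAt (𝓡 m) x).symm y))
      ((EuclideanSpace.proj j : EuclideanSpace ℝ (Fin m) →L[ℝ] ℝ).comp (chartDeriv x _))) =
      localComponent x K j y :=
  pullback_single _ _ _

variable [IsManifold (𝓡 m) ∞ M]

theorem chartDeriv_comp_chartFrame (x : M) {y : EuclideanSpace ℝ (Fin m)}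
    (hy : y ∈ (extChartAt (𝓡 m) x).target) :
    (chartDeriv x ((extChartAt (𝓡 m) x).symm y)).comp (chartFrame x y) =
      ContinuousLinearMap.id ℝ _ := by
  have h := mfderiv_extChartAt_comp_mfderivWithin_extChartAt_symm (I := 𝓡 m) hy
  simp only [ModelWithCorners.range_eq_univ, mfderivWithin_univ] at h
  exact h

theorem chartFrame_comp_chartDeriv (x : M) {y : EuclideanSpace ℝ (Fin m)}
    (hy : y ∈ (extChartAt (𝓡 m) x).target) :
    (chartFrame x y).comp (chartDeriv x ((extChartAt (𝓡 m) x).symm y)) =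
      ContinuousLinearMap.id ℝ _ := by
  have h := mfderivWithin_extChartAt_symm_comp_mfderiv_extChartAt (I := 𝓡 m) hy
  simp only [ModelWithCorners.range_eq_univ, mfderivWithin_univ] at h
  exact h

theorem sum_chart_coframe_smul_frame (x : M) {y : EuclideanSpace ℝ (Fin m)}
    (hy : y ∈ (extChartAt (𝓡 m) x).target)
    (X : TangentSpace (𝓡 m) ((extChartAt (𝓡 m) x).symm y)) :
    ∑ j, ((EuclideanSpace.proj j : EuclideanSpace ℝ (Fin m) →L[ℝ] ℝ).comp (chartDeriv x _)) X •
      chartFrame x y (stdFrame m j) = X := by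
  have h := congrArg (chartFrame x y) (sum_proj_smul_stdFrame (chartDeriv x _ X))
  rw [map_sum] at h
  simp only [map_smul] at h
  refine h.trans ?_
  exact congrArg (fun f => f X) (chartFrame_comp_chartDeriv x hy)

/-- `insertion` uses at each point the frame of that point's own chart, which need not vary
continuously; frame independence replaces it by the coordinate frame of the chart at `x`, valid on
the whole chart. -/
theorem localForm_insertion (x : M) {k : ℕ} (K : VectorForms m M k) (η : Forms m M)
    {y : EuclideanSpace ℝ (Fin m)} (hy : y ∈ (extChartAt (𝓡 m) x).target) :
    localForm x (insertion K η) y =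
      localInsertion (stdFrame m) (localComponent x K) (localForm x η) y := by
  have h := sum_wedge_interior_frame (sum_coframe_smul_frame ((extChartAt (𝓡 m) x).symm y))
    (sum_chart_coframe_smul_frame x hy) (K _) (η _)
  rw [localForm_eq]
  refine (congrArg (pullback (chartFrame x y)) h).trans ?_
  simp only [map_sum, pullback_wedge, pullback_interior, pullback_covectorComp]
  rfl

theorem localForm_contraction (x : M) {k : ℕ} (K : VectorForms m M k)
    {y : EuclideanSpace ℝ (Fin m)} (hy : y ∈ (extChartAt (𝓡 m) x).target) :
    localForm x (contraction K) y =
      localContraction (stdFrame m) (localComponent x K) y := by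
  have h := sum_interior_frame (sum_coframe_smul_frame ((extChartAt (𝓡 m) x).symm y))
    (sum_chart_coframe_smul_frame x hy) (K _)
  rw [localForm_eq]
  refine (congrArg (pullback (chartFrame x y)) h).trans ?_
  simp only [map_sum, pullback_interior, pullback_covectorComp]
  rfl

theorem localForm_concomitant (x : M) {k l : ℕ} (K : VectorForms m M k) (L : VectorForms m M l)
    {y : EuclideanSpace ℝ (Fin m)} (hy : y ∈ (extChartAt (𝓡 m) x).target) :
    localForm x (concomitant K L) y =
      localConcomitant (stdFrame m) (localComponent x K) (localComponent x L) y := by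
  have h := sum_sum_wedge_frame (sum_coframe_smul_frame ((extChartAt (𝓡 m) x).symm y))
    (sum_chart_coframe_smul_frame x hy) (K _) (L _)
  rw [localForm_eq]
  refine (congrArg (pullback (chartFrame x y)) h).trans ?_
  simp only [map_sum, pullback_wedge, pullback_interior, pullback_covectorComp]
  rfl

end Charts

/-! ### Derivatives in the chart, and the bracket. -/

section ChartCalculus

variable {m : ℕ} {M : Type*} [TopologicalSpace M] [ChartedSpace (EuclideanSpace ℝ (Fin m)) M]

theorem insertion_coordFun {k : ℕ} (K : VectorForms m M k) (x : M) (j : Fin m) :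
    insertion K (coordFun x j) = 0 := by
  funext p
  refine Finset.sum_eq_zero fun i _ => ?_
  rw [coordFun, interior_single_zero, wedge_zero_right]

theorem coordFun_zero (x : M) (j : Fin m) (q : M) : coordFun x j q 0 =
    ContinuousAlternatingMap.constOfIsEmpty ℝ (TangentSpace (𝓡 m) q) (Fin 0)
      ((extChartAt (𝓡 m) x q).ofLp j) := Pi.single_eq_same _ _

theorem coordFun_succ (x : M) (j : Fin m) (q : M) (n : ℕ) : coordFun x j q (n + 1) = 0 :=
  Pi.single_eq_of_ne (Nat.succ_ne_zero n) _

theorem extD_zero : extD (0 : Forms m M) = 0 := by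
  funext p n
  cases n with
  | zero => rfl
  | succ n =>
    have h : inChart p n (0 : Forms m M) = fun _ => 0 := rfl
    rw [extD, h, extDeriv_zero_form]
    rfl

/-- The derivative at `x` of the inverse of the chart at `x`. -/
def frameMap (x : M) : EuclideanSpace ℝ (Fin m) →L[ℝ] TangentSpace (𝓡 m) x :=
  (mfderiv (𝓡 m) 𝓘(ℝ, EuclideanSpace ℝ (Fin m)) (extChartAt (𝓡 m) x) x).inverse

theorem frame_eq_frameMap (x : M) (j : Fin m) : frame x j = frameMap x (stdFrame m j) := rfl

open Topology in
theorem eventually_mem_target (x : M) :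
    ∀ᶠ y in 𝓝 (extChartAt (𝓡 m) x x), y ∈ (extChartAt (𝓡 m) x).target :=
  extChartAt_target_mem_nhds x

/-- The only use of smoothness: the components need to be differentiable once, at the base point. -/
theorem DiffAt.localComponent (x : M) {k : ℕ} {K : VectorForms m M k} (hK : IsSmooth K)
    (j : Fin m) : DiffAt (localComponent x K j) (extChartAt (𝓡 m) x x) := by
  intro n
  by_cases h : n = k
  · subst h
    simp only [FrolicherNijenhuis.localComponent, Pi.single_eq_same]
    have := ((hK x).contDiffAt (extChartAt_target_mem_nhds x)).differentiableAt (by simp)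
    exact (ContinuousLinearMap.compContinuousAlternatingMapCLM ℝ _ _ _ _
      (EuclideanSpace.proj j : EuclideanSpace ℝ (Fin m) →L[ℝ] ℝ)).differentiableAt.comp _ this
  · simp only [FrolicherNijenhuis.localComponent, Pi.single_eq_of_ne h]
    exact differentiableAt_const _

variable [IsManifold (𝓡 m) ∞ M]

theorem chartDeriv_comp_frameMap (x : M) :
    (chartDeriv x x).comp (frameMap x) = ContinuousLinearMap.id ℝ (EuclideanSpace ℝ (Fin m)) := by
  obtain ⟨e, he⟩ := isInvertible_mfderiv_extChartAt (I := 𝓡 m) (mem_extChartAt_source x)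
  rw [chartDeriv, frameMap, ← he, ContinuousLinearMap.inverse_equiv]
  exact e.coe_comp_coe_symm

theorem frameMap_comp_chartDeriv (x : M) :
    (frameMap x).comp (chartDeriv x x) = ContinuousLinearMap.id ℝ (TangentSpace (𝓡 m) x) := by
  obtain ⟨e, he⟩ := isInvertible_mfderiv_extChartAt (I := 𝓡 m) (mem_extChartAt_source x)
  rw [chartDeriv, frameMap, ← he, ContinuousLinearMap.inverse_equiv]
  exact e.coe_symm_comp_coe

/-- The inverse chart returns `x` only up to a propositional equality, so the tangent spaces differ
as types; a variable `p` makes substitution possible. -/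
theorem eq_frameMap {x p : M} (h : p = x) (A : EuclideanSpace ℝ (Fin m) →L[ℝ] TangentSpace (𝓡 m) p)
    (hA : (chartDeriv x p).comp A = ContinuousLinearMap.id ℝ _) (η : Forms m M) :
    pullback A (η p) = pullback (frameMap x) (η x) := by
  subst h
  have : A = frameMap p := by
    have := congrArg (fun f => (frameMap p).comp f) hA
    simp only [← ContinuousLinearMap.comp_assoc, frameMap_comp_chartDeriv] at this
    exact this
  rw [this]

theorem localForm_base (x : M) (η : Forms m M) :
    localForm x η (extChartAt (𝓡 m) x x) = pullback (frameMap x) (η x) :=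
  eq_frameMap (extChartAt_to_inv (I := 𝓡 m) x) _
    (chartDeriv_comp_chartFrame x (mem_extChartAt_target x)) η

theorem pullback_frameMap_injective (x : M) : 
    Function.Injective (pullback (frameMap x : EuclideanSpace ℝ (Fin m) →L[ℝ] _)) := by
  intro α β h
  funext n
  ext v
  have h' := congrArg (fun γ => γ n (chartDeriv x x ∘ v)) h
  have e : frameMap x ∘ chartDeriv x x ∘ v = v := funext fun i =>
    congrArg (fun f => f (v i)) (frameMap_comp_chartDeriv x)
  change α n (frameMap x ∘ chartDeriv x x ∘ v) = β n (frameMap x ∘ chartDeriv x x ∘ v) at h'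
  rwa [e] at h'

/-- Only at the base point, where the chart that defines `extD` is the chart at `x` itself. -/
theorem localForm_extD (x : M) (η : Forms m M) :
    localForm x (extD η) (extChartAt (𝓡 m) x x) =
      localD (localForm x η) (extChartAt (𝓡 m) x x) := by
  rw [localForm_base]
  funext n
  cases n with
  | zero => rfl
  | succ n =>
    ext v
    change extDeriv (inChart x n η) _ (chartDeriv x x ∘ frameMap x ∘ v) = _
    have e : chartDeriv x x ∘ frameMap x ∘ v = v := funext fun i =>
      congrArg (fun f => f (v i)) (chartDeriv_comp_frameMap x)
    rw [e]
    rfl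

theorem localForm_lieDeriv (x : M) {k : ℕ} (K : VectorForms m M k) (η : Forms m M) :
    localForm x (lieDeriv K η) (extChartAt (𝓡 m) x x) =
      localLieDeriv k (stdFrame m) (localComponent x K) (localForm x η)
        (extChartAt (𝓡 m) x x) := by
  have h : localForm x (lieDeriv K η) (extChartAt (𝓡 m) x x) =
      localForm x (insertion K (extD η)) (extChartAt (𝓡 m) x x) - (-1 : ℝ) ^ (k + 1) •
        localForm x (extD (insertion K η)) (extChartAt (𝓡 m) x x) := rfl
  have h' := localD_congr ((eventually_mem_target x).mono fun y hy => localForm_insertion x K η hy)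
  rw [h, localForm_insertion x K _ (mem_extChartAt_target x), localForm_extD, h', localLieDeriv,
    localInsertion, localInsertion, localForm_extD]

open Topology in
-- The chain rule for the coordinate function written as its expression in the chart at `p` composed
-- with that chart. It makes `duʲ` known on the whole chart at `x`, although `extD` changes charts
-- from point to point.
theorem fderiv_coord_comp_chartDeriv (x p : M) (hp : p ∈ (extChartAt (𝓡 m) x).source) (j : Fin m) :
    (fderiv ℝ (fun z => (extChartAt (𝓡 m) x ((extChartAt (𝓡 m) p).symm z)).ofLp j)
      (extChartAt (𝓡 m) p p)).comp (chartDeriv p p) =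
      (EuclideanSpace.proj j : EuclideanSpace ℝ (Fin m) →L[ℝ] ℝ).comp (chartDeriv x p) := by
  let g : M → ℝ := fun q => (extChartAt (𝓡 m) x q).ofLp j
  have hp' : p ∈ (chartAt (EuclideanSpace ℝ (Fin m)) x).source := by
    rwa [extChartAt_source] at hp
  have h1 : HasMFDerivAt (𝓡 m) 𝓘(ℝ, EuclideanSpace ℝ (Fin m)) (extChartAt (𝓡 m) x) p
      (chartDeriv x p) := (mdifferentiableAt_extChartAt (I := 𝓡 m) hp').hasMFDerivAt
  have hg : HasMFDerivAt (𝓡 m) 𝓘(ℝ, ℝ) g p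
      ((EuclideanSpace.proj j : EuclideanSpace ℝ (Fin m) →L[ℝ] ℝ).comp (chartDeriv x p)) :=
    HasMFDerivAt.comp p (EuclideanSpace.proj j : EuclideanSpace ℝ (Fin m) →L[ℝ] ℝ).hasMFDerivAt h1
  have h2 : HasMFDerivAt (𝓡 m) 𝓘(ℝ, EuclideanSpace ℝ (Fin m)) (extChartAt (𝓡 m) p) p
      (chartDeriv p p) := (mdifferentiableAt_extChartAt (I := 𝓡 m)
        (mem_chart_source _ p)).hasMFDerivAt
  have h3 : MDifferentiableAt 𝓘(ℝ, EuclideanSpace ℝ (Fin m)) (𝓡 m) (extChartAt (𝓡 m) p).symm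
      (extChartAt (𝓡 m) p p) := by
    have := mdifferentiableWithinAt_extChartAt_symm (I := 𝓡 m) (mem_extChartAt_target (I := 𝓡 m) p)
    rwa [ModelWithCorners.range_eq_univ, mdifferentiableWithinAt_univ] at this
  have h4 : MDifferentiableAt 𝓘(ℝ, EuclideanSpace ℝ (Fin m)) 𝓘(ℝ, ℝ)
      (g ∘ (extChartAt (𝓡 m) p).symm) (extChartAt (𝓡 m) p p) := by
    refine MDifferentiableAt.comp _ ?_ h3
    rw [extChartAt_to_inv]
    exact hg.mdifferentiableAt
  have h5 : HasMFDerivAt 𝓘(ℝ, EuclideanSpace ℝ (Fin m)) 𝓘(ℝ, ℝ)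
      (g ∘ (extChartAt (𝓡 m) p).symm) (extChartAt (𝓡 m) p p)
      (fderiv ℝ (g ∘ (extChartAt (𝓡 m) p).symm) (extChartAt (𝓡 m) p p)) :=
    h4.differentiableAt.hasFDerivAt.hasMFDerivAt
  have h6 := HasMFDerivAt.comp p h5 h2
  have h7 : (g ∘ (extChartAt (𝓡 m) p).symm) ∘ extChartAt (𝓡 m) p =ᶠ[𝓝 p] g := by
    filter_upwards [extChartAt_source_mem_nhds (I := 𝓡 m) p] with q hq
    simp only [Function.comp_apply, (extChartAt (𝓡 m) p).left_inv hq]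
  exact hasMFDerivAt_unique (h6.congr_of_eventuallyEq h7.symm) hg

theorem localForm_extD_coordFun (x : M) (j : Fin m) {y : EuclideanSpace ℝ (Fin m)}
    (hy : y ∈ (extChartAt (𝓡 m) x).target) :
    localForm x (extD (coordFun x j)) y =
      Pi.single 1 (ContinuousAlternatingMap.ofSubsingleton ℝ _ ℝ (0 : Fin 1)
        (EuclideanSpace.proj j : EuclideanSpace ℝ (Fin m) →L[ℝ] ℝ)) := by
  rw [localForm_eq]
  set p := (extChartAt (𝓡 m) x).symm y
  have hps : p ∈ (extChartAt (𝓡 m) x).source := (extChartAt (𝓡 m) x).map_target hy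
  funext n
  match n with
  | 0 => rfl
  | 1 =>
    rw [Pi.single_eq_same]
    ext v
    have h0 : inChart p 0 (coordFun x j) = fun z => ContinuousAlternatingMap.constOfIsEmpty ℝ
        (EuclideanSpace ℝ (Fin m)) (Fin 0)
        ((extChartAt (𝓡 m) x ((extChartAt (𝓡 m) p).symm z)).ofLp j) := by
      funext z
      rw [inChart, coordFun_zero]
      rfl
    change extDeriv (inChart p 0 (coordFun x j)) _ (chartDeriv p p ∘ chartFrame x y ∘ v) = _
    rw [h0, extDeriv_constOfIsEmpty]
    have h1 := congrArg (fun f => f (chartFrame x y (v 0))) (fderiv_coord_comp_chartDeriv x p hps j)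
    refine h1.trans ?_
    exact congrArg (fun f => (f (v 0)).ofLp j) (chartDeriv_comp_chartFrame x hy)
  | n + 2 =>
    rw [Pi.single_eq_of_ne (by omega)]
    have h0 : inChart p (n + 1) (coordFun x j) = fun _ => 0 := by
      funext z
      rw [inChart, coordFun_succ]
      rfl
    change ((extDeriv (inChart p (n + 1) (coordFun x j)) _).compContinuousLinearMap
      _).compContinuousLinearMap _ = _
    rw [h0, extDeriv_zero_form]
    rfl

/-- Valid on the whole chart, as needed for the outer Lie derivative to be applied. Since `i(K) uʲ =
0`, only `i(K) duʲ` remains, and `duʲ(e_a) = δ_{aj}` selects one component. -/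
theorem localForm_lieDeriv_coordFun (x : M) {k : ℕ} (K : VectorForms m M k) (j : Fin m)
    {y : EuclideanSpace ℝ (Fin m)} (hy : y ∈ (extChartAt (𝓡 m) x).target) :
    localForm x (lieDeriv K (coordFun x j)) y = localComponent x K j y := by
  have h : lieDeriv K (coordFun x j) = insertion K (extD (coordFun x j)) := by
    rw [lieDeriv, insertion_coordFun, extD_zero, smul_zero, sub_zero]
  have h1 : ∀ a, interior (stdFrame m a) (Pi.single 1
      (ContinuousAlternatingMap.ofSubsingleton ℝ _ ℝ (0 : Fin 1)
        (EuclideanSpace.proj j : EuclideanSpace ℝ (Fin m) →L[ℝ] ℝ)) :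
          AltForms (EuclideanSpace ℝ (Fin m))) =
      (Pi.single 0 (ContinuousAlternatingMap.constOfIsEmpty ℝ (EuclideanSpace ℝ (Fin m)) (Fin 0)
        (stdFrame m a j : ℝ)) : AltForms (EuclideanSpace ℝ (Fin m))) := by
    intro a
    have hd := (hasDegree_single (k := 1) (ContinuousAlternatingMap.ofSubsingleton ℝ _ ℝ
      (0 : Fin 1) (EuclideanSpace.proj j : EuclideanSpace ℝ (Fin m) →L[ℝ] ℝ))).interior
        (stdFrame m a)
    rw [Nat.cast_one, sub_self] at hd
    refine (HasDegree.single_eq (n := 0) hd).symm.trans ?_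
    congr 1
  rw [h, localForm_insertion x K _ hy, localInsertion, localForm_extD_coordFun x j hy]
  simp only [h1, wedge_single_zero]
  rw [Finset.sum_eq_single j]
  · simp [stdFrame]
  · intro a _ ha
    simp [stdFrame, ha.symm]
  · simp

theorem component_bracket {k l : ℕ} (K : VectorForms m M k) (L : VectorForms m M l) (x : M)
    (j : Fin m) : component (bracket K L) j x =
      Pi.single (k + l) (lieDerivComm K L (coordFun x j) x (k + l)) := by
  have h : ∀ i, coframe x j (frame x i) = if i = j then 1 else 0 := fun i => by
    have := congrArg (fun f => (f (stdFrame m i)).ofLp j) (chartDeriv_comp_frameMap x)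
    refine this.trans ?_
    simp [stdFrame, eq_comm]
  rw [component]
  congr 1
  ext v
  simp [bracket, map_sum, h]

theorem localForm_lieDerivComm_coordFun {k l : ℕ} (K : VectorForms m M k) (L : VectorForms m M l)
    (x : M) (j : Fin m) :
    localForm x (lieDerivComm K L (coordFun x j)) (extChartAt (𝓡 m) x x) =
      localLieDeriv k (stdFrame m) (localComponent x K) (localComponent x L j)
        (extChartAt (𝓡 m) x x) - (-1 : ℝ) ^ (k * l) •
      localLieDeriv l (stdFrame m) (localComponent x L) (localComponent x K j)
        (extChartAt (𝓡 m) x x) := by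
  rw [← localLieDeriv_congr k _ _ ((eventually_mem_target x).mono fun y hy =>
      localForm_lieDeriv_coordFun x L j hy), ← localLieDeriv_congr l _ _
      ((eventually_mem_target x).mono fun y hy => localForm_lieDeriv_coordFun x K j hy),
    ← localForm_lieDeriv, ← localForm_lieDeriv]
  rfl

theorem localForm_contraction_bracket {k l : ℕ} (K : VectorForms m M k) (L : VectorForms m M l)
    (x : M) : localForm x (contraction (bracket K L)) (extChartAt (𝓡 m) x x) =
      ∑ j, interior (stdFrame m j) (localForm x (lieDerivComm K L (coordFun x j))
        (extChartAt (𝓡 m) x x)) := by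
  rw [localForm_base, contraction, map_sum]
  refine Finset.sum_congr rfl fun j _ => ?_
  rw [frame_eq_frameMap, pullback_interior, component_bracket, pullback_single]
  congr 1
  -- `bracket` keeps only the component of degree `k + l`; nothing is lost, as the commutator on a
  -- coordinate function lies in that degree.
  have hd : HasDegree ((k + l : ℕ) : ℤ) (localForm x (lieDerivComm K L (coordFun x j))
      (extChartAt (𝓡 m) x x)) := by
    rw [localForm_lieDerivComm_coordFun]
    have h1 := HasDegree.localLieDeriv (stdFrame m) (localComponent_hasDegree x K)
      (localComponent_hasDegree x L j) (y := extChartAt (𝓡 m) x x)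
    have h2 := HasDegree.localLieDeriv (stdFrame m) (localComponent_hasDegree x L)
      (localComponent_hasDegree x K j) (y := extChartAt (𝓡 m) x x)
    rw [add_comm] at h2
    push_cast
    exact h1.sub (h2.smul _)
  rw [← hd.single_eq, localForm_base]
  rfl

end ChartCalculus

end FrolicherNijenhuis

theorem lemma2p3 {m : ℕ} {M : Type*} [TopologicalSpace M]
    [ChartedSpace (EuclideanSpace ℝ (Fin m)) M] [IsManifold (𝓡 m) ∞ M] {k l : ℕ}
    (K : FrolicherNijenhuis.VectorForms m M k) (L : FrolicherNijenhuis.VectorForms m M l)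
    (hK : FrolicherNijenhuis.IsSmooth K) (hL : FrolicherNijenhuis.IsSmooth L) :
    FrolicherNijenhuis.contraction (FrolicherNijenhuis.bracket K L) =
      (-1 : ℝ) ^ k • FrolicherNijenhuis.lieDeriv K (FrolicherNijenhuis.contraction L)
      - (-1 : ℝ) ^ (k * l + l) • FrolicherNijenhuis.lieDeriv L (FrolicherNijenhuis.contraction K)
      - (-1 : ℝ) ^ k • FrolicherNijenhuis.extD (FrolicherNijenhuis.concomitant K L) := by
  open FrolicherNijenhuis in
  funext x
  -- Forms at `x` are compared through their expressions at the base point of the chart. The local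
  -- expressions of contraction and concomitant hold near that point, so they may be substituted
  -- under `d`.
  apply pullback_frameMap_injective x
  rw [← localForm_base, localForm_contraction_bracket]
  simp only [localForm_lieDerivComm_coordFun]
  rw [sum_interior_bracket (stdFrame m) (fun a => DiffAt.localComponent x hK a)
    (fun a => DiffAt.localComponent x hL a) (localComponent_hasParity x K)
    (localComponent_hasParity x L),
    ← localLieDeriv_congr k _ _ ((eventually_mem_target x).mono fun y hy =>
      localForm_contraction x L hy),
    ← localLieDeriv_congr l _ _ ((eventually_mem_target x).mono fun y hy =>
      localForm_contraction x K hy),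
    ← localD_congr ((eventually_mem_target x).mono fun y hy => localForm_concomitant x K L hy),
    ← localForm_lieDeriv, ← localForm_lieDeriv, ← localForm_extD, localForm_base, localForm_base,
    localForm_base]
  simp only [Pi.sub_apply, Pi.smul_apply, map_sub, map_smul]

end
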